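/- Let $\Lambda$ be a finite set and let $\mathcal H_\Lambda=\bigotimes_{x\in\Lambda}\mathbb C^3$. Let $S^1,S^2,S^3$ be the usual spin operators on $\mathbb C^3$ for spin $S=1$ (hermitian, with $[S^1,S^2]=\mathrm iS^3$ and its cyclic permutations, and $(S^1)^2+(S^2)^2+(S^3)^2=S(S+1)\,\mathbb 1=2\cdot\mathbb 1$), and let $S_x^i=S^i\otimes\mathbb 1_{\Lambda\setminus\{x\}}$ be the spin operators at the site $x\in\Lambda$. Let $J_A^i\ge 0$ for all $A\subset\Lambda$ and $i\in\{1,2\}$, and let $$H_\Lambda=-\sum_{A\subset\Lambda}\Bigl(J_A^1\prod_{x\in A}S_x^1+J_A^2\prod_{x\in A}S_x^2\Bigr).$$ For $\beta>0$, $s\in[0,1]$ and operators $a,b$ on $\mathcal H_\Lambda$, let $$\langle a\rangle=\frac{\operatorname{Tr}\,a\,\mathrm e^{-\beta H_\Lambda}}{\operatorname{Tr}\,\mathrm e^{-\beta H_\Lambda}},\qquad \langle a;b\rangle_s=\frac{\operatorname{Tr}\,a\,\mathrm e^{-s\beta H_\Lambda}\,b\,\mathrm e^{-(1-s)\beta H_\Lambda}}{\operatorname{Tr}\,\mathrm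 e^{-\beta H_\Lambda}}.$$ Then for all $A,B\subset\Lambda$ and all $s\in[0,1]$ the following two limits exist, are real, and satisfy $$\lim_{\beta\to\infty}\Bigl[\Bigl\langle\prod_{x\in A}S_x^1;\prod_{x\in B}S_x^1\Bigr\rangle_s-\Bigl\langle\prod_{x\in A}S_x^1\Bigr\rangle\Bigl\langle\prod_{x\in B}S_x^1\Bigr\rangle\Bigr]\ge 0,$$ $$\lim_{\beta\to\infty}\Bigl[\Bigl\langle\prod_{x\in A}S_x^1;\prod_{x\in B}S_x^2\Bigr\rangle_s-\Bigl\langle\prod_{x\in A}S_x^1\Bigr\rangle\Bigl\langle\prod_{x\in B}S_x^2\Bigr\rangle\Bigr]\le 0.$$ -/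

import Mathlib

noncomputable section

/-- The first spin-1 matrix, in the basis of eigenvectors of the third one. -/
def spinOne1 : Matrix (Fin 3) (Fin 3) ℂ :=
  ((1 / Real.sqrt 2 : ℝ) : ℂ) • !![0, 1, 0; 1, 0, 1; 0, 1, 0]

/-- The second spin-1 matrix. -/
def spinOne2 : Matrix (Fin 3) (Fin 3) ℂ :=
  ((1 / Real.sqrt 2 : ℝ) : ℂ) •
    !![0, -Complex.I, 0; Complex.I, 0, -Complex.I; 0, Complex.I, 0]

/-- The third spin-1 matrix (it enters only the relations that characterise the triple). -/
def spinOne3 : Matrix (Fin 3) (Fin 3) ℂ := !![1, 0, 0; 0, 0, 0; 0, 0, -1]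

theorem spinOne_factor_sq :
    ((1 / Real.sqrt 2 : ℝ) : ℂ) * ((1 / Real.sqrt 2 : ℝ) : ℂ) = 1 / 2 := by
  rw [← Complex.ofReal_mul, div_mul_div_comm, Real.mul_self_sqrt (by norm_num)]
  norm_num

set_option linter.unusedSimpArgs false in
/-- The matrices are hermitian and satisfy the relations of spin operators with `S = 1`. -/
theorem spinOne_relations :
    spinOne1.IsHermitian ∧ spinOne2.IsHermitian ∧ spinOne3.IsHermitian ∧
    spinOne1 * spinOne2 - spinOne2 * spinOne1 = Complex.I • spinOne3 ∧
    spinOne2 * spinOne3 - spinOne3 * spinOne2 = Complex.I • spinOne1 ∧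
    spinOne3 * spinOne1 - spinOne1 * spinOne3 = Complex.I • spinOne2 ∧
    spinOne1 * spinOne1 + spinOne2 * spinOne2 + spinOne3 * spinOne3 =
      ((1 : ℂ) * (1 + 1)) • (1 : Matrix (Fin 3) (Fin 3) ℂ) := by
  have h := spinOne_factor_sq
  unfold spinOne1 spinOne2 spinOne3
  generalize hc : ((1 / Real.sqrt 2 : ℝ) : ℂ) = c at h ⊢
  have hs : star c = c := by rw [← hc]; exact Complex.conj_ofReal _
  have hI := Complex.I_mul_I
  refine ⟨?_, ?_, ?_, ?_, ?_, ?_, ?_⟩ <;> ext i j <;> fin_cases i <;> fin_cases j <;>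
    simp [Matrix.mul_apply, Fin.sum_univ_three] <;>
    first
      | done
      | simpa using hs
      | grind

variable {Λ : Type*} [Fintype Λ] [DecidableEq Λ]

/-- Operators on `⨂_{x ∈ Λ} ℂ³`, as matrices in the product basis, which is indexed by the
configurations `Λ → Fin 3`. -/
abbrev SpinOp (Λ : Type*) : Type _ := Matrix (Λ → Fin 3) (Λ → Fin 3) ℂ

/-- The operator `⨂_{x ∈ Λ} M x`. -/
def tensorOp (M : Λ → Matrix (Fin 3) (Fin 3) ℂ) : SpinOp Λ :=
  Matrix.of fun σ τ => ∏ x, M x (σ x) (τ x)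

/-- The operator `M_x = M ⊗ 1_{Λ \ {x}}`. -/
def siteOp (M : Matrix (Fin 3) (Fin 3) ℂ) (x : Λ) : SpinOp Λ :=
  tensorOp (Pi.mulSingle x M)

theorem tensorOp_mul (M N : Λ → Matrix (Fin 3) (Fin 3) ℂ) :
    tensorOp M * tensorOp N = tensorOp (M * N) := by
  ext σ τ
  simp only [tensorOp, Matrix.mul_apply, Matrix.of_apply, Pi.mul_apply, Finset.prod_univ_sum,
    Fintype.piFinset_univ, Finset.prod_mul_distrib]

theorem siteOp_commute (M : Matrix (Fin 3) (Fin 3) ℂ) (x y : Λ) :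
    Commute (siteOp M x) (siteOp M y) := by
  have hc : Commute (Pi.mulSingle x M : Λ → Matrix (Fin 3) (Fin 3) ℂ) (Pi.mulSingle y M) :=
    Pi.mulSingle_apply_commute (fun _ : Λ => M) x y
  unfold siteOp Commute SemiconjBy
  rw [tensorOp_mul, tensorOp_mul, hc.eq]

/-- The product `∏_{x ∈ A} M_x`; its factors commute. -/
def siteProd (M : Matrix (Fin 3) (Fin 3) ℂ) (A : Finset Λ) : SpinOp Λ :=
  A.noncommProd (siteOp M) fun x _ y _ _ => siteOp_commute M x y

/-- The hamiltonian `H_Λ = - ∑_{A ⊆ Λ} (J¹_A ∏_{x ∈ A} S¹_x + J²_A ∏_{x ∈ A} S²_x)` with `S = 1`. -/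
def xyHamiltonian (J₁ J₂ : Finset Λ → ℝ) : SpinOp Λ :=
  -∑ A : Finset Λ, ((J₁ A : ℂ) • siteProd spinOne1 A + (J₂ A : ℂ) • siteProd spinOne2 A)

/-- The partition function `Tr e^{-βH}`. -/
def partitionFn (H : SpinOp Λ) (β : ℝ) : ℂ :=
  (NormedSpace.exp (-(β : ℂ) • H)).trace

/-- The Gibbs state `⟨a⟩ = Z⁻¹ Tr (a e^{-βH})`. -/
def gibbs (H : SpinOp Λ) (β : ℝ) (a : SpinOp Λ) : ℂ :=
  (a * NormedSpace.exp (-(β : ℂ) • H)).trace / partitionFn H β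

/-- The Schwinger function `⟨a ; b⟩_s = Z⁻¹ Tr (a e^{-sβH} b e^{-(1-s)βH})`. -/
def schwinger (H : SpinOp Λ) (β s : ℝ) (a b : SpinOp Λ) : ℂ :=
  (a * NormedSpace.exp (-((s * β : ℝ) : ℂ) • H) * b *
    NormedSpace.exp (-(((1 - s) * β : ℝ) : ℂ) • H)).trace / partitionFn H β

end

/-!
# Ground state Griffiths inequalities for the spin-1 quantum XY model

**Griffiths inequalities in the extended system.** `ℂ³` is the symmetric (triplet) subspace of
`ℂ² ⊗ ℂ²`, and the spin-1 operators are the restrictions of `R = (σ ⊗ 1 + 1 ⊗ σ) / 2`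
(`pairSpin`), which vanish on the singlet. Replacing each `ℂ³` by `ℂ² ⊗ ℂ²` gives an extended
hamiltonian with the same couplings. In two copies of it, there is a product basis in which
`a ⊗ 1 + 1 ⊗ a` and `a ⊗ 1 - 1 ⊗ a` have nonnegative entries for every product `a` of first spin
operators, and `b ⊗ 1 + 1 ⊗ b` and `-(b ⊗ 1 - 1 ⊗ b)` for every product `b` of second ones
(`IsDoublePositive`). The doubled Gibbs operators then have nonnegative entries too, and since
truncated correlations are traces of products of such doubled operators, their signs follow
(`IsDoublePositive.truncated_nonneg`), at all temperatures and in the limit.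

**Ground states are triplets at all coupled sites.** In the spin-1 system the traces run over the
triplets only, so it has to be shown that the ground states of the extended system contain no
singlets at a site `x` that occurs in the interaction (`singlet_mul_groundProjection_eq_zero`).
Write the hamiltonian as `H₀ - R_x K - R'_x K'`, where `H₀`, `K`, `K'` act away from `x`. Suppose
that there is a ground state with a singlet at `x`. Replacing the singlet by a triplet state `φ`
with `⟨φ|R|φ⟩ = ⟨φ|R'|φ⟩ = 0` does not change the energy, so the result is a ground state again,
which forces `K = 0` on the original state and then on all ground states of `H₀`. By the Griffiths
inequalities for `H₀`, some `R_y²` has vanishing ground state expectation, that is, `R_y`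
annihilates the ground states of `H₀`. As `R'_y` has no matrix elements in the kernel of `R_y`,
these states do not feel the interaction with `y` either; hence the state at `y` can be replaced by
`φ`, on which `R_y` does not vanish: a contradiction.

**Comparison.** At a site that does not occur in the interaction, all operators factorize, and
passing from `ℂ² ⊗ ℂ²` to the triplets multiplies a trace by `3/4`, or by `1` if an observable acts
there. The truncated ground state correlation of the spin-1 system is therefore a positive multiple
of that of the extended system (`exists_tendsto_truncated`).
-/

open Matrix
open scoped ComplexOrder Kronecker

/-! ### Tensor products and one-site operators -/

section Tensor
variable {Λ α β γ : Type*} [Fintype Λ]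

/-- The tensor product `⨂ₓ M x` of a family of (possibly rectangular) matrices, in the product
bases indexed by configurations. -/
def piTensor (M : Λ → Matrix α β ℂ) : Matrix (Λ → α) (Λ → β) ℂ :=
  Matrix.of fun σ τ => ∏ x, M x (σ x) (τ x)

theorem piTensor_apply (M : Λ → Matrix α β ℂ) (σ : Λ → α) (τ : Λ → β) :
    piTensor M σ τ = ∏ x, M x (σ x) (τ x) := rfl

theorem piTensor_mul [DecidableEq Λ] [Fintype β] (M : Λ → Matrix α β ℂ) (N : Λ → Matrix β γ ℂ) :
    piTensor M * piTensor N = piTensor fun x => M x * N x := by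
  ext σ τ
  simp only [piTensor, Matrix.mul_apply, Matrix.of_apply, Finset.prod_univ_sum,
    Fintype.piFinset_univ, Finset.prod_mul_distrib]

theorem piTensor_one [DecidableEq Λ] [DecidableEq α] :
    piTensor (fun _ : Λ => (1 : Matrix α α ℂ)) = 1 := by
  ext σ τ
  rw [piTensor_apply]
  by_cases h : σ = τ
  · subst h; simp
  · obtain ⟨x, hx⟩ := Function.ne_iff.1 h
    rw [Matrix.one_apply_ne h]
    exact Finset.prod_eq_zero (Finset.mem_univ x) (Matrix.one_apply_ne hx)

theorem piTensor_const_smul (c : ℂ) (M : Λ → Matrix α β ℂ) :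
    piTensor (fun x => c • M x) = c ^ Fintype.card Λ • piTensor M := by
  ext σ τ
  simp [piTensor_apply, Finset.prod_mul_distrib, Finset.card_univ]

theorem piTensor_conjTranspose (M : Λ → Matrix α β ℂ) :
    (piTensor M)ᴴ = piTensor fun x => (M x)ᴴ := by
  ext σ τ
  simp [piTensor_apply, Matrix.conjTranspose_apply]

end Tensor

section Site
variable {Λ κ : Type*} [Fintype Λ] [DecidableEq Λ] [DecidableEq κ]

/-- The operator `M ⊗ 1` acting as `M` at the site `x`. -/
def siteEmbed (x : Λ) (M : Matrix κ κ ℂ) : Matrix (Λ → κ) (Λ → κ) ℂ :=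
  piTensor fun y => if y = x then M else 1

/-- The product over `x ∈ A` of the operators `M` acting at the site `x`. -/
def regionProd (M : Matrix κ κ ℂ) (A : Finset Λ) : Matrix (Λ → κ) (Λ → κ) ℂ :=
  piTensor fun y => if y ∈ A then M else 1

theorem siteEmbed_apply (x : Λ) (M : Matrix κ κ ℂ) (σ τ : Λ → κ) :
    siteEmbed x M σ τ =
      M (σ x) (τ x) * ∏ y ∈ Finset.univ.erase x, (1 : Matrix κ κ ℂ) (σ y) (τ y) := by
  unfold siteEmbed
  rw [piTensor_apply, ← Finset.mul_prod_erase _ _ (Finset.mem_univ x)]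
  congr 1
  · simp
  · refine Finset.prod_congr rfl fun y hy => ?_
    rw [if_neg (Finset.ne_of_mem_erase hy)]

theorem siteEmbed_one (x : Λ) : siteEmbed x (1 : Matrix κ κ ℂ) = 1 := by
  unfold siteEmbed
  simp [piTensor_one]

theorem siteEmbed_conjTranspose (x : Λ) (M : Matrix κ κ ℂ) :
    (siteEmbed x M)ᴴ = siteEmbed x Mᴴ := by
  unfold siteEmbed
  rw [piTensor_conjTranspose]
  congr 1; funext y; split_ifs <;> simp

theorem regionProd_empty (M : Matrix κ κ ℂ) : regionProd M (∅ : Finset Λ) = 1 := by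
  unfold regionProd
  simp [piTensor_one]

theorem regionProd_conjTranspose (M : Matrix κ κ ℂ) (A : Finset Λ) :
    (regionProd M A)ᴴ = regionProd Mᴴ A := by
  unfold regionProd
  rw [piTensor_conjTranspose]
  congr 1; funext y; split_ifs <;> simp

theorem siteEmbed_add (x : Λ) (M N : Matrix κ κ ℂ) :
    siteEmbed x (M + N) = siteEmbed x M + siteEmbed x N := by
  ext σ τ
  simp [siteEmbed_apply, add_mul]

theorem siteEmbed_smul (x : Λ) (c : ℂ) (M : Matrix κ κ ℂ) :
    siteEmbed x (c • M) = c • siteEmbed x M := by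
  ext σ τ
  simp [siteEmbed_apply, mul_assoc]

theorem siteEmbed_zero (x : Λ) : siteEmbed x (0 : Matrix κ κ ℂ) = 0 := by
  simpa using siteEmbed_smul x 0 (0 : Matrix κ κ ℂ)

theorem siteEmbed_sub (x : Λ) (M N : Matrix κ κ ℂ) :
    siteEmbed x (M - N) = siteEmbed x M - siteEmbed x N := by
  ext σ τ
  simp [siteEmbed_apply, sub_mul]

theorem siteEmbed_sum {ι : Type*} (x : Λ) (s : Finset ι) (M : ι → Matrix κ κ ℂ) :
    siteEmbed x (∑ i ∈ s, M i) = ∑ i ∈ s, siteEmbed x (M i) := by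
  ext σ τ
  simp [siteEmbed_apply, Matrix.sum_apply, Finset.sum_mul]

variable [Fintype κ]

theorem siteEmbed_mul (x : Λ) (M N : Matrix κ κ ℂ) :
    siteEmbed x (M * N) = siteEmbed x M * siteEmbed x N := by
  unfold siteEmbed
  rw [piTensor_mul]
  congr 1; funext y; split_ifs <;> simp

theorem regionProd_insert (M : Matrix κ κ ℂ) {x : Λ} {A : Finset Λ} (hx : x ∉ A) :
    regionProd M (insert x A) = siteEmbed x M * regionProd M A := by
  unfold regionProd siteEmbed
  rw [piTensor_mul]
  congr 1; funext y
  by_cases h : y = x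
  · subst h; simp [hx]
  · simp [h]

theorem regionProd_mul_self (M : Matrix κ κ ℂ) (A : Finset Λ) :
    regionProd M A * regionProd M A = regionProd (M * M) A := by
  unfold regionProd
  rw [piTensor_mul]
  congr 1; funext y; split_ifs <;> simp

/-- An operator which acts trivially at the site `x`: it commutes with all operators there. -/
def ActsAwayFrom (x : Λ) (X : Matrix (Λ → κ) (Λ → κ) ℂ) : Prop :=
  ∀ M : Matrix κ κ ℂ, Commute (siteEmbed x M) X

theorem siteEmbed_commute_regionProd {x : Λ} {A : Finset Λ} {M N : Matrix κ κ ℂ}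
    (h : x ∈ A → Commute M N) : Commute (siteEmbed x M) (regionProd N A) := by
  unfold Commute SemiconjBy regionProd siteEmbed
  rw [piTensor_mul, piTensor_mul]
  congr 1; funext y
  by_cases hy : y = x
  · subst hy
    by_cases hA : y ∈ A
    · simpa [hA] using (h hA).eq
    · simp [hA]
  · simp [hy]

theorem regionProd_actsAwayFrom {x : Λ} {A : Finset Λ} (N : Matrix κ κ ℂ) (h : x ∉ A) :
    ActsAwayFrom x (regionProd N A) :=
  fun _ => siteEmbed_commute_regionProd fun hx => absurd hx h

namespace ActsAwayFrom
variable {x : Λ} {X Y : Matrix (Λ → κ) (Λ → κ) ℂ}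

theorem mul (hX : ActsAwayFrom x X) (hY : ActsAwayFrom x Y) : ActsAwayFrom x (X * Y) :=
  fun M => (hX M).mul_right (hY M)

theorem add (hX : ActsAwayFrom x X) (hY : ActsAwayFrom x Y) : ActsAwayFrom x (X + Y) :=
  fun M => (hX M).add_right (hY M)

theorem neg (hX : ActsAwayFrom x X) : ActsAwayFrom x (-X) := fun M => (hX M).neg_right

theorem smul (hX : ActsAwayFrom x X) (c : ℂ) : ActsAwayFrom x (c • X) :=
  fun M => (hX M).smul_right c

theorem sum {ι : Type*} {s : Finset ι} {X : ι → Matrix (Λ → κ) (Λ → κ) ℂ}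
    (h : ∀ i ∈ s, ActsAwayFrom x (X i)) : ActsAwayFrom x (∑ i ∈ s, X i) :=
  fun M => Commute.sum_right _ _ _ fun i hi => h i hi M

end ActsAwayFrom

/-- Averaging over matrix units gives the trace. -/
theorem sum_single_mul_mul_single (M : Matrix κ κ ℂ) :
    ∑ j, ∑ k, Matrix.single j k (1 : ℂ) * M * Matrix.single k j (1 : ℂ) = M.trace • 1 := by
  ext a b
  simp only [Matrix.sum_apply, Matrix.single_mul_mul_single, Matrix.trace, Matrix.smul_apply,
    Matrix.one_apply, Matrix.single_apply, smul_eq_mul, Matrix.diag_apply, one_mul, mul_one]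
  by_cases h : a = b
  · subst h
    rw [Finset.sum_eq_single a]
    · simp
    · intro j _ hj; simp [hj]
    · simp
  · simp only [h, if_false, mul_zero]
    refine Finset.sum_eq_zero fun j _ => Finset.sum_eq_zero fun k _ => if_neg ?_
    rintro ⟨rfl, rfl⟩; exact h rfl

theorem sum_single_mul_single :
    ∑ j : κ, ∑ k : κ, Matrix.single k j (1 : ℂ) * Matrix.single j k (1 : ℂ) =
      (Fintype.card κ : ℂ) • 1 := by
  have h : ∑ k : κ, Matrix.single k k (1 : ℂ) = 1 := by
    ext a b
    simp [Matrix.sum_apply, Matrix.single_apply, Matrix.one_apply, ite_and]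
  simp [h, Finset.card_univ, Nat.cast_smul_eq_nsmul]

/-- An operator acting trivially at `x` has a factorizing trace against operators at `x`. -/
theorem ActsAwayFrom.trace_siteEmbed_mul {x : Λ} {X : Matrix (Λ → κ) (Λ → κ) ℂ}
    (hX : ActsAwayFrom x X) (M : Matrix κ κ ℂ) :
    (Fintype.card κ : ℂ) * (siteEmbed x M * X).trace = M.trace * X.trace := by
  have h1 : ∑ j, ∑ k, (siteEmbed x (Matrix.single j k (1 : ℂ) * M * Matrix.single k j (1 : ℂ))
      * X).trace = M.trace * X.trace := by
    simp only [← Matrix.trace_sum, ← Finset.sum_mul, ← siteEmbed_sum,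
      sum_single_mul_mul_single, siteEmbed_smul, siteEmbed_one]
    simp
  have h2 : ∑ j : κ, ∑ k : κ, (siteEmbed x (Matrix.single k j (1 : ℂ) *
      Matrix.single j k (1 : ℂ)) * (siteEmbed x M * X)).trace =
      (Fintype.card κ : ℂ) * (siteEmbed x M * X).trace := by
    simp only [← Matrix.trace_sum, ← Finset.sum_mul, ← siteEmbed_sum,
      sum_single_mul_single, siteEmbed_smul, siteEmbed_one]
    simp
  rw [← h1, ← h2, Finset.sum_congr rfl]
  intro j _
  refine Finset.sum_congr rfl fun k _ => ?_
  rw [siteEmbed_mul, siteEmbed_mul, siteEmbed_mul]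
  generalize siteEmbed x (Matrix.single j k (1 : ℂ)) = p
  generalize hq : siteEmbed x (Matrix.single k j (1 : ℂ)) = q
  have hqX : q * X = X * q := by rw [← hq]; exact hX _
  generalize siteEmbed x M = m
  calc (q * p * (m * X)).trace = (q * (p * m * X)).trace := by simp only [mul_assoc]
    _ = (p * m * X * q).trace := Matrix.trace_mul_comm _ _
    _ = _ := by simp only [mul_assoc, hqX]

end Site

/-! ### Ground state projections -/

section Exp
variable {m n : Type*} [Fintype m] [DecidableEq m] [Fintype n] [DecidableEq n]

theorem hasSum_matrix_exp (A : Matrix n n ℂ) :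
    HasSum (fun k : ℕ => ((k.factorial : ℂ)⁻¹) • A ^ k) (NormedSpace.exp A) := by
  let : NormedRing (Matrix n n ℂ) := Matrix.linftyOpNormedRing
  let : NormedAlgebra ℂ (Matrix n n ℂ) := Matrix.linftyOpNormedAlgebra
  exact NormedSpace.exp_series_hasSum_exp' (𝕂 := ℂ) A

/-- A matrix intertwining two matrices also intertwines their exponentials. -/
theorem exp_mul_eq_mul_exp {A : Matrix m m ℂ} {B : Matrix n n ℂ} {V : Matrix m n ℂ}
    (h : A * V = V * B) : NormedSpace.exp A * V = V * NormedSpace.exp B := by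
  have hk : ∀ k : ℕ, A ^ k * V = V * B ^ k := by
    intro k
    induction k with
    | zero => simp
    | succ k ih => rw [pow_succ, pow_succ, Matrix.mul_assoc, h, ← Matrix.mul_assoc, ih,
        Matrix.mul_assoc]
  have h1 := (hasSum_matrix_exp A).map
    (AddMonoidHom.mk' (fun X : Matrix m m ℂ => X * V) fun X Y => Matrix.add_mul X Y V)
    (continuous_id.matrix_mul continuous_const)
  have h2 := (hasSum_matrix_exp B).map
    (AddMonoidHom.mk' (fun X : Matrix n n ℂ => V * X) fun X Y => Matrix.mul_add V X Y)
    (continuous_const.matrix_mul continuous_id)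
  have h3 : (fun k : ℕ => (((k.factorial : ℂ)⁻¹) • A ^ k) * V) =
      fun k : ℕ => V * (((k.factorial : ℂ)⁻¹) • B ^ k) := by
    funext k
    rw [Matrix.smul_mul, hk, Matrix.mul_smul]
  exact HasSum.unique (f := fun k : ℕ => (((k.factorial : ℂ)⁻¹) • A ^ k) * V) h1 (h3 ▸ h2)

theorem exp_smul_one (c : ℂ) :
    NormedSpace.exp (c • (1 : Matrix n n ℂ)) = Complex.exp c • 1 := by
  rw [Matrix.smul_one_eq_diagonal, Matrix.exp_diagonal, Matrix.smul_one_eq_diagonal]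
  congr 1
  funext i
  rw [Pi.coe_exp, Complex.exp_eq_exp_ℂ]

/-- `e^{t(E - H)}`. -/
noncomputable def boltzmann (H : Matrix n n ℂ) (E t : ℝ) : Matrix n n ℂ :=
  Complex.exp ((t * E : ℝ) : ℂ) • NormedSpace.exp (-(t : ℂ) • H)

theorem boltzmann_mul_of_eigen {H : Matrix n n ℂ} {E F : ℝ} {X : Matrix n m ℂ}
    (h : H * X = (F : ℂ) • X) (t : ℝ) :
    boltzmann H E t * X = Complex.exp ((t * (E - F) : ℝ) : ℂ) • X := by
  have h1 : (-(t : ℂ) • H) * X = X * ((-(t : ℂ) * F) • (1 : Matrix m m ℂ)) := by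
    rw [Matrix.smul_mul, h, smul_smul, Matrix.mul_smul, Matrix.mul_one]
  rw [boltzmann, Matrix.smul_mul, exp_mul_eq_mul_exp h1, exp_smul_one, Matrix.mul_smul,
    Matrix.mul_one, smul_smul, ← Complex.exp_add]
  congr 2
  push_cast; ring

/-- `E` is the lowest eigenvalue of the hermitian matrix `H` and `P` is the orthogonal projection
onto its eigenspace; the projection is pinned down as the limit of `e^{t(E - H)}`. -/
structure IsGroundProjection (H : Matrix n n ℂ) (E : ℝ) (P : Matrix n n ℂ) : Prop where
  posSemidef : (H - (E : ℂ) • 1).PosSemidef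
  tendsto : Filter.Tendsto (boltzmann H E) Filter.atTop (nhds P)
  mul_eq : H * P = (E : ℂ) • P
  ne_zero : P ≠ 0

theorem exists_isGroundProjection [Nonempty n] {H : Matrix n n ℂ} (hH : H.IsHermitian) :
    ∃ E P, IsGroundProjection H E P := by
  obtain ⟨i₀, hi₀⟩ := Finite.exists_min hH.eigenvalues
  set U : Matrix n n ℂ := (hH.eigenvectorUnitary : Matrix n n ℂ) with hU
  have hUU : U * Uᴴ = 1 := Unitary.coe_mul_star_self hH.eigenvectorUnitary
  have hUU' : Uᴴ * U = 1 := Unitary.coe_star_mul_self hH.eigenvectorUnitary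
  set d : n → ℂ := fun i => (hH.eigenvalues i : ℂ) with hd
  have hspec : H = U * diagonal d * Uᴴ := by
    conv_lhs => rw [hH.spectral_theorem]
    rfl
  set E := hH.eigenvalues i₀ with hE
  have hHU : H * U = U * diagonal d := by
    rw [hspec, Matrix.mul_assoc, Matrix.mul_assoc, hUU', Matrix.mul_one]
  let p : n → ℂ := fun i => if hH.eigenvalues i = E then 1 else 0
  refine ⟨E, U * diagonal p * Uᴴ, ?_, ?_, ?_, ?_⟩
  · have : H - (E : ℂ) • 1 = U * diagonal (fun i => d i - E) * Uᴴ := by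
      have h1 : diagonal (fun i => d i - (E : ℂ)) = diagonal d - (E : ℂ) • (1 : Matrix n n ℂ) := by
        rw [Matrix.smul_one_eq_diagonal, Matrix.diagonal_sub]
      rw [h1, Matrix.mul_sub, Matrix.sub_mul, ← hspec, Matrix.mul_smul, Matrix.mul_one,
        Matrix.smul_mul, hUU]
    rw [this]
    refine (Matrix.PosSemidef.diagonal ?_).mul_mul_conjTranspose_same U
    intro i
    simp only [hd, Pi.zero_apply, ← Complex.ofReal_sub]
    exact Complex.zero_le_real.2 (sub_nonneg.2 (hi₀ i))
  · have hb : boltzmann H E = fun t : ℝ => U * diagonal (fun i =>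
        Complex.exp ((t * (E - hH.eigenvalues i) : ℝ) : ℂ)) * Uᴴ := by
      funext t
      have h1 : (-(t : ℂ) • H) * U = U * diagonal (fun i => -(t : ℂ) * d i) := by
        rw [Matrix.smul_mul, hHU, ← Matrix.mul_smul]
        congr 1
        ext i j; simp [Matrix.diagonal_apply]
      have h2 := exp_mul_eq_mul_exp h1
      have h3 : boltzmann H E t = boltzmann H E t * U * Uᴴ := by
        rw [Matrix.mul_assoc, hUU, Matrix.mul_one]
      rw [h3, boltzmann, Matrix.smul_mul, h2, Matrix.exp_diagonal, ← Matrix.mul_smul]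
      congr 2
      ext i j
      by_cases hij : i = j
      · subst hij
        simp only [Matrix.smul_apply, Matrix.diagonal_apply_eq, Pi.coe_exp, smul_eq_mul,
          ← Complex.exp_eq_exp_ℂ, ← Complex.exp_add, hd]
        congr 1; push_cast; ring
      · simp [hij]
    rw [hb]
    refine Filter.Tendsto.mul (Filter.Tendsto.mul tendsto_const_nhds ?_) tendsto_const_nhds
    refine ((continuous_id.matrix_diagonal).tendsto p).comp (tendsto_pi_nhds.2 fun i => ?_)
    by_cases hi : hH.eigenvalues i = E
    · simp [p, hi]
    · have hlt : E - hH.eigenvalues i < 0 := sub_neg.2 (lt_of_le_of_ne (hi₀ i) (Ne.symm hi))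
      simp only [p, hi, if_false, ← Complex.ofReal_exp]
      have := (Real.tendsto_exp_atBot.comp
        (Filter.tendsto_id.atTop_mul_const_of_neg hlt))
      exact (Complex.continuous_ofReal.tendsto 0).comp this
  · rw [← Matrix.mul_assoc, ← Matrix.mul_assoc, hHU, Matrix.mul_assoc U,
      Matrix.diagonal_mul_diagonal]
    rw [← Matrix.smul_mul, ← Matrix.mul_smul]
    congr 2
    ext i j
    by_cases hij : i = j
    · subst hij
      by_cases hi : hH.eigenvalues i = E <;> simp [p, hi, hd]
    · simp [hij]
  · intro h0
    have h1 : diagonal p = 0 := by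
      have : Uᴴ * (U * diagonal p * Uᴴ) * U = diagonal p := by
        rw [Matrix.mul_assoc, Matrix.mul_assoc, hUU', Matrix.mul_one, ← Matrix.mul_assoc, hUU',
          Matrix.one_mul]
      rw [← this, h0]; simp
    have := congrFun (congrFun h1 i₀) i₀
    simp [p, hE] at this

namespace IsGroundProjection
variable {H P : Matrix n n ℂ} {E : ℝ}

theorem isHermitian_hamiltonian (h : IsGroundProjection H E P) : H.IsHermitian := by
  have h1 : (((E : ℂ)) • (1 : Matrix n n ℂ)).IsHermitian := by
    rw [Matrix.IsHermitian, Matrix.conjTranspose_smul]; simp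
  simpa using h.posSemidef.1.add h1

theorem mul_of_eigen (h : IsGroundProjection H E P) {X : Matrix n n ℂ}
    (hX : H * X = (E : ℂ) • X) : P * X = X := by
  have h1 : Filter.Tendsto (fun t => boltzmann H E t * X) Filter.atTop (nhds (P * X)) :=
    ((continuous_id.matrix_mul continuous_const).tendsto P).comp h.tendsto
  refine tendsto_nhds_unique h1 ?_
  have : (fun t => boltzmann H E t * X) = fun _ => X := by
    funext t; rw [boltzmann_mul_of_eigen hX]; simp
  rw [this]
  exact tendsto_const_nhds

theorem mul_self (h : IsGroundProjection H E P) : P * P = P := h.mul_of_eigen h.mul_eq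

theorem isHermitian (h : IsGroundProjection H E P) : P.IsHermitian := by
  have h1 : Filter.Tendsto (fun t => (boltzmann H E t)ᴴ) Filter.atTop (nhds Pᴴ) :=
    ((continuous_id.matrix_conjTranspose).tendsto P).comp h.tendsto
  refine tendsto_nhds_unique h1 ?_
  have : (fun t => (boltzmann H E t)ᴴ) = boltzmann H E := by
    funext t
    have h2 : (-(t : ℂ) • H)ᴴ = -(t : ℂ) • H := by
      rw [Matrix.conjTranspose_smul, h.isHermitian_hamiltonian.eq]; simp
    rw [boltzmann, Matrix.conjTranspose_smul, ← Matrix.exp_conjTranspose, h2]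
    congr 1
    rw [Complex.star_def, ← Complex.exp_conj, Complex.conj_ofReal]
  rw [this]
  exact h.tendsto

/-- The variational principle: a family of trial vectors with energy `E` consists of
ground vectors. -/
theorem eigen_of_trial (h : IsGroundProjection H E P) {X : Matrix n n ℂ}
    (hX : Xᴴ * ((H - (E : ℂ) • 1) * X) = 0) : H * X = (E : ℂ) • X := by
  have h3 : (H - (E : ℂ) • 1) * X = 0 := by
    ext i j
    refine congrFun ((h.posSemidef.dotProduct_mulVec_zero_iff (fun k => X k j)).1 ?_) i
    exact congrFun (congrFun hX j) j
  rw [Matrix.sub_mul, Matrix.smul_mul, Matrix.one_mul, sub_eq_zero] at h3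
  exact h3

theorem le_eigenvalue (h : IsGroundProjection H E P) {X : Matrix n n ℂ} {F : ℝ}
    (hX : H * X = (F : ℂ) • X) (h0 : X ≠ 0) : E ≤ F := by
  have h1 := (h.posSemidef.conjTranspose_mul_mul_same X).trace_nonneg
  have h2 : Xᴴ * (H - (E : ℂ) • 1) * X = ((F - E : ℝ) : ℂ) • (Xᴴ * X) := by
    rw [Matrix.mul_assoc, Matrix.sub_mul, hX, Matrix.smul_mul, Matrix.one_mul, ← sub_smul,
      Matrix.mul_smul]
    push_cast; rfl
  have h3 := (Matrix.posSemidef_conjTranspose_mul_self X).trace_nonneg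
  have h4 : (Xᴴ * X).trace ≠ 0 := fun h => h0 (Matrix.trace_conjTranspose_mul_self_eq_zero_iff.1 h)
  rw [h2, Matrix.trace_smul, smul_eq_mul] at h1
  rw [Complex.le_def] at h1 h3
  simp only [Complex.zero_re, Complex.zero_im, Complex.mul_re, Complex.ofReal_re,
    Complex.ofReal_im, zero_mul, sub_zero] at h1 h3
  have h5 : 0 < ((Xᴴ * X).trace).re := by
    refine lt_of_le_of_ne h3.1 fun h => h4 (Complex.ext h.symm h3.2.symm)
  have := nonneg_of_mul_nonneg_left h1.1 h5
  linarith

theorem trace_pos (h : IsGroundProjection H E P) : 0 < P.trace := by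
  have h1 : Pᴴ * P = P := by rw [h.isHermitian.eq, h.mul_self]
  have h3 := (Matrix.posSemidef_conjTranspose_mul_self P).trace_nonneg
  rw [h1] at h3
  refine lt_of_le_of_ne h3 fun h0 => h.ne_zero ?_
  refine Matrix.trace_conjTranspose_mul_self_eq_zero_iff.1 ?_
  rw [h1, h0]

theorem commute_of_commute (h : IsGroundProjection H E P) {X : Matrix n n ℂ}
    (hX : Commute X H) : Commute X P := by
  have h0 : ∀ t, X * boltzmann H E t = boltzmann H E t * X := by
    intro t
    rw [boltzmann, Matrix.mul_smul, Matrix.smul_mul, exp_mul_eq_mul_exp (B := -(t : ℂ) • H)]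
    exact ((hX.smul_right _).eq).symm
  have h1 : Filter.Tendsto (fun t => boltzmann H E t * X) Filter.atTop (nhds (P * X)) :=
    ((continuous_id.matrix_mul continuous_const).tendsto P).comp h.tendsto
  have h2 : Filter.Tendsto (fun t => X * boltzmann H E t) Filter.atTop (nhds (X * P)) :=
    ((continuous_const.matrix_mul continuous_id).tendsto P).comp h.tendsto
  refine tendsto_nhds_unique h2 ?_
  simpa only [h0] using h1

end IsGroundProjection
end Exp

/-! ### Positive cones and Griffiths inequalities -/

section Exp
variable {n m : Type*} [Fintype n] [DecidableEq n] [Fintype m] [DecidableEq m]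

theorem exp_kronecker_one (A : Matrix n n ℂ) :
    NormedSpace.exp (A ⊗ₖ (1 : Matrix m m ℂ)) = NormedSpace.exp A ⊗ₖ (1 : Matrix m m ℂ) := by
  have hk : ∀ k : ℕ, (A ⊗ₖ (1 : Matrix m m ℂ)) ^ k = (A ^ k) ⊗ₖ (1 : Matrix m m ℂ) := by
    intro k
    induction k with
    | zero => simp
    | succ k ih => rw [pow_succ, pow_succ, ih, ← Matrix.mul_kronecker_mul, Matrix.one_mul]
  have hc : Continuous fun X : Matrix n n ℂ => X ⊗ₖ (1 : Matrix m m ℂ) := by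
    refine continuous_pi fun i => continuous_pi fun j => ?_
    exact ((continuous_id.matrix_elem i.1 j.1).mul continuous_const)
  have h1 := (hasSum_matrix_exp A).map
    (AddMonoidHom.mk' (fun X : Matrix n n ℂ => X ⊗ₖ (1 : Matrix m m ℂ))
      fun X Y => Matrix.add_kronecker X Y 1) hc
  have h2 := hasSum_matrix_exp (A ⊗ₖ (1 : Matrix m m ℂ))
  have h3 : (fun k : ℕ => ((k.factorial : ℂ)⁻¹) • (A ⊗ₖ (1 : Matrix m m ℂ)) ^ k) =
      fun k : ℕ => (((k.factorial : ℂ)⁻¹) • A ^ k) ⊗ₖ (1 : Matrix m m ℂ) := by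
    funext k
    rw [hk, Matrix.smul_kronecker]
  exact HasSum.unique
    (f := fun k : ℕ => (((k.factorial : ℂ)⁻¹) • A ^ k) ⊗ₖ (1 : Matrix m m ℂ)) (h3 ▸ h2) h1

theorem exp_one_kronecker (A : Matrix n n ℂ) :
    NormedSpace.exp ((1 : Matrix m m ℂ) ⊗ₖ A) = (1 : Matrix m m ℂ) ⊗ₖ NormedSpace.exp A := by
  have hk : ∀ k : ℕ, ((1 : Matrix m m ℂ) ⊗ₖ A) ^ k = (1 : Matrix m m ℂ) ⊗ₖ (A ^ k) := by
    intro k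
    induction k with
    | zero => simp
    | succ k ih => rw [pow_succ, pow_succ, ih, ← Matrix.mul_kronecker_mul, Matrix.one_mul]
  have hc : Continuous fun X : Matrix n n ℂ => (1 : Matrix m m ℂ) ⊗ₖ X := by
    refine continuous_pi fun i => continuous_pi fun j => ?_
    exact (continuous_const.mul (continuous_id.matrix_elem i.2 j.2))
  have h1 := (hasSum_matrix_exp A).map
    (AddMonoidHom.mk' (fun X : Matrix n n ℂ => (1 : Matrix m m ℂ) ⊗ₖ X)
      fun X Y => Matrix.kronecker_add 1 X Y) hc
  have h2 := hasSum_matrix_exp ((1 : Matrix m m ℂ) ⊗ₖ A)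
  have h3 : (fun k : ℕ => ((k.factorial : ℂ)⁻¹) • ((1 : Matrix m m ℂ) ⊗ₖ A) ^ k) =
      fun k : ℕ => (1 : Matrix m m ℂ) ⊗ₖ (((k.factorial : ℂ)⁻¹) • A ^ k) := by
    funext k
    rw [hk, Matrix.kronecker_smul]
  exact HasSum.unique
    (f := fun k : ℕ => (1 : Matrix m m ℂ) ⊗ₖ (((k.factorial : ℂ)⁻¹) • A ^ k)) (h3 ▸ h2) h1

theorem exp_kronecker_sum (A : Matrix n n ℂ) :
    NormedSpace.exp (A ⊗ₖ (1 : Matrix n n ℂ) + (1 : Matrix n n ℂ) ⊗ₖ A) =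
      NormedSpace.exp A ⊗ₖ NormedSpace.exp A := by
  have hc : Commute (A ⊗ₖ (1 : Matrix n n ℂ)) ((1 : Matrix n n ℂ) ⊗ₖ A) := by
    unfold Commute SemiconjBy
    rw [← Matrix.mul_kronecker_mul, ← Matrix.mul_kronecker_mul]
    simp
  rw [Matrix.exp_add_of_commute _ _ hc, exp_kronecker_one, exp_one_kronecker,
    ← Matrix.mul_kronecker_mul]
  simp

end Exp

section Cone
variable {n m : Type*} [Fintype n] {W : Matrix n m ℂ} {c : ℝ}

/-- The matrices whose entries in the basis of the columns of `W` are nonnegative reals. -/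
def positiveCone (W : Matrix n m ℂ) : Set (Matrix n n ℂ) :=
  {M | ∀ i j, 0 ≤ (Wᴴ * M * W) i j}

theorem add_mem_positiveCone {M N : Matrix n n ℂ} (hM : M ∈ positiveCone W)
    (hN : N ∈ positiveCone W) : M + N ∈ positiveCone W := by
  intro i j
  rw [Matrix.mul_add, Matrix.add_mul]
  exact add_nonneg (hM i j) (hN i j)

theorem smul_mem_positiveCone {M : Matrix n n ℂ} {z : ℂ} (hz : 0 ≤ z)
    (hM : M ∈ positiveCone W) : z • M ∈ positiveCone W := by
  intro i j
  rw [Matrix.mul_smul, Matrix.smul_mul]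
  exact mul_nonneg hz (hM i j)

theorem isClosed_positiveCone : IsClosed (positiveCone W) := by
  unfold positiveCone
  simp only [Set.ofPred_forall]
  refine isClosed_iInter fun i => isClosed_iInter fun j => ?_
  have h : Continuous fun M : Matrix n n ℂ => (Wᴴ * M * W) i j :=
    ((continuous_const.matrix_mul continuous_id).matrix_mul continuous_const).matrix_elem i j
  exact isClosed_le continuous_const h
variable [DecidableEq n] [Fintype m] [DecidableEq m]

/-- The columns of `W` form an orthogonal basis, all of whose vectors have square norm `c`. -/
structure IsOrthogonalFrame (W : Matrix n m ℂ) (c : ℝ) : Prop where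
  pos : 0 < c
  mul_conjTranspose : W * Wᴴ = (c : ℂ) • 1
  conjTranspose_mul : Wᴴ * W = (c : ℂ) • 1

namespace IsOrthogonalFrame

theorem one_mem (hW : IsOrthogonalFrame W c) : (1 : Matrix n n ℂ) ∈ positiveCone W := by
  intro i j
  rw [Matrix.mul_one, hW.conjTranspose_mul, Matrix.smul_apply, Matrix.one_apply]
  split_ifs
  · simpa using hW.pos.le
  · simp

theorem mul_mem (hW : IsOrthogonalFrame W c) {M N : Matrix n n ℂ} (hM : M ∈ positiveCone W)
    (hN : N ∈ positiveCone W) : M * N ∈ positiveCone W := by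
  have h : (Wᴴ * M * W) * (Wᴴ * N * W) = (c : ℂ) • (Wᴴ * (M * N) * W) := by
    calc (Wᴴ * M * W) * (Wᴴ * N * W) = Wᴴ * M * (W * Wᴴ) * (N * W) := by
          simp only [Matrix.mul_assoc]
      _ = _ := by
          rw [hW.mul_conjTranspose, Matrix.mul_smul, Matrix.smul_mul, Matrix.mul_one]
          simp only [Matrix.mul_assoc]
  have hc : (0 : ℂ) < c := by exact_mod_cast hW.pos
  intro i j
  have h1 : 0 ≤ ((Wᴴ * M * W) * (Wᴴ * N * W)) i j := by
    rw [Matrix.mul_apply]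
    exact Finset.sum_nonneg fun k _ => mul_nonneg (hM i k) (hN k j)
  rw [h, Matrix.smul_apply, smul_eq_mul] at h1
  exact le_of_mul_le_mul_left (by simpa using h1) hc

theorem exp_mem (hW : IsOrthogonalFrame W c) {M : Matrix n n ℂ} (hM : M ∈ positiveCone W) :
    NormedSpace.exp M ∈ positiveCone W := by
  have hk : ∀ k : ℕ, M ^ k ∈ positiveCone W := by
    intro k
    induction k with
    | zero => simpa using hW.one_mem
    | succ k ih => rw [pow_succ]; exact hW.mul_mem ih hM
  refine isClosed_positiveCone.mem_of_tendsto (hasSum_matrix_exp M) (Filter.Eventually.of_forall ?_)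
  intro s
  refine Finset.sum_induction _ (· ∈ positiveCone W) (fun _ _ => add_mem_positiveCone) ?_ ?_
  · intro i j; simp
  · intro k _
    refine smul_mem_positiveCone ?_ (hk k)
    positivity

theorem trace_nonneg (hW : IsOrthogonalFrame W c) {M : Matrix n n ℂ} (hM : M ∈ positiveCone W) :
    0 ≤ M.trace := by
  have h1 : 0 ≤ (Wᴴ * M * W).trace := Finset.sum_nonneg fun i _ => hM i i
  rw [Matrix.trace_mul_comm, ← Matrix.mul_assoc, hW.mul_conjTranspose, Matrix.smul_mul,
    Matrix.one_mul, Matrix.trace_smul, smul_eq_mul] at h1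
  have hc : (0 : ℂ) < c := by exact_mod_cast hW.pos
  exact le_of_mul_le_mul_left (by simpa using h1) hc

end IsOrthogonalFrame
end Cone

section Griffiths
variable {n m : Type*} [Fintype n] {W : Matrix (n × n) m ℂ} {c : ℝ}

theorem tendsto_kronecker_mem {l : Filter ℝ} [l.NeBot] {f : ℝ → Matrix n n ℂ} {P : Matrix n n ℂ}
    (hf : Filter.Tendsto f l (nhds P)) (h : ∀ᶠ t in l, f t ⊗ₖ f t ∈ positiveCone W) :
    P ⊗ₖ P ∈ positiveCone W := by
  have hc : Continuous fun X : Matrix n n ℂ => X ⊗ₖ X := by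
    refine continuous_pi fun i => continuous_pi fun j => ?_
    exact (continuous_id.matrix_elem i.1 j.1).mul (continuous_id.matrix_elem i.2 j.2)
  exact isClosed_positiveCone.mem_of_tendsto ((hc.tendsto P).comp hf) h

variable [DecidableEq n]

/-- An operator `a` such that `a ⊗ 1 + 1 ⊗ a` and `ε (a ⊗ 1 - 1 ⊗ a)` have nonnegative entries in
the basis `W` of the doubled space; `ε` is a sign. -/
def IsDoublePositive (W : Matrix (n × n) m ℂ) (ε : ℂ) (a : Matrix n n ℂ) : Prop :=
  a ⊗ₖ (1 : Matrix n n ℂ) + (1 : Matrix n n ℂ) ⊗ₖ a ∈ positiveCone W ∧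
    ε • (a ⊗ₖ (1 : Matrix n n ℂ) - (1 : Matrix n n ℂ) ⊗ₖ a) ∈ positiveCone W

namespace IsDoublePositive
variable {ε : ℂ} {a b : Matrix n n ℂ}

theorem add (ha : IsDoublePositive W ε a) (hb : IsDoublePositive W ε b) :
    IsDoublePositive W ε (a + b) := by
  refine ⟨?_, ?_⟩
  · convert add_mem_positiveCone ha.1 hb.1 using 1
    rw [Matrix.add_kronecker, Matrix.kronecker_add]; abel
  · convert add_mem_positiveCone ha.2 hb.2 using 1
    rw [Matrix.add_kronecker, Matrix.kronecker_add, ← smul_add]; congr 1; abel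

theorem smul {z : ℂ} (hz : 0 ≤ z) (ha : IsDoublePositive W ε a) :
    IsDoublePositive W ε (z • a) := by
  refine ⟨?_, ?_⟩
  · convert smul_mem_positiveCone hz ha.1 using 1
    rw [Matrix.smul_kronecker, Matrix.kronecker_smul, smul_add]
  · convert smul_mem_positiveCone hz ha.2 using 1
    rw [Matrix.smul_kronecker, Matrix.kronecker_smul, ← smul_sub, smul_comm]

theorem zero : IsDoublePositive W ε (0 : Matrix n n ℂ) := by
  constructor <;> intro i j <;> simp

theorem sum {ι : Type*} {s : Finset ι} {f : ι → Matrix n n ℂ}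
    (h : ∀ i ∈ s, IsDoublePositive W ε (f i)) : IsDoublePositive W ε (∑ i ∈ s, f i) :=
  Finset.sum_induction _ _ (fun _ _ => add) zero h

variable [Fintype m] [DecidableEq m]

theorem one (hW : IsOrthogonalFrame W c) : IsDoublePositive W ε (1 : Matrix n n ℂ) := by
  refine ⟨?_, ?_⟩
  · simpa using add_mem_positiveCone hW.one_mem hW.one_mem
  · intro i j; simp

theorem mul (hW : IsOrthogonalFrame W c) (hε : ε * ε = 1) (ha : IsDoublePositive W ε a)
    (hb : IsDoublePositive W ε b) : IsDoublePositive W ε (a * b) := by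
  have h1 : (a * b) ⊗ₖ (1 : Matrix n n ℂ) = (a ⊗ₖ (1 : Matrix n n ℂ)) * (b ⊗ₖ 1) := by
    rw [← Matrix.mul_kronecker_mul, Matrix.one_mul]
  have h2 : (1 : Matrix n n ℂ) ⊗ₖ (a * b) = ((1 : Matrix n n ℂ) ⊗ₖ a) * (1 ⊗ₖ b) := by
    rw [← Matrix.mul_kronecker_mul, Matrix.one_mul]
  have hhalf : (0 : ℂ) ≤ 1 / 2 := by
    rw [show (1 / 2 : ℂ) = ((1 / 2 : ℝ) : ℂ) by push_cast; rfl]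
    exact Complex.zero_le_real.2 (by norm_num)
  obtain ⟨ha1, ha2⟩ := ha
  obtain ⟨hb1, hb2⟩ := hb
  unfold IsDoublePositive
  rw [h1, h2]
  generalize a ⊗ₖ (1 : Matrix n n ℂ) = p at *
  generalize (1 : Matrix n n ℂ) ⊗ₖ a = q at *
  generalize b ⊗ₖ (1 : Matrix n n ℂ) = r at *
  generalize (1 : Matrix n n ℂ) ⊗ₖ b = s at *
  refine ⟨?_, ?_⟩
  · convert smul_mem_positiveCone hhalf
      (add_mem_positiveCone (hW.mul_mem ha1 hb1) (hW.mul_mem ha2 hb2)) using 1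
    rw [Matrix.smul_mul, Matrix.mul_smul, smul_smul, hε, one_smul]
    rw [show (p + q) * (r + s) + (p - q) * (r - s) = (2 : ℂ) • (p * r + q * s) by
      rw [two_smul]; noncomm_ring]
    rw [smul_smul]; norm_num
  · convert smul_mem_positiveCone hhalf
      (add_mem_positiveCone (hW.mul_mem ha1 hb2) (hW.mul_mem ha2 hb1)) using 1
    rw [Matrix.smul_mul, Matrix.mul_smul, ← smul_add]
    rw [show (p + q) * (r - s) + (p - q) * (r + s) = (2 : ℂ) • (p * r - q * s) by
      rw [two_smul]; noncomm_ring]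
    rw [smul_smul, smul_smul]
    congr 1; ring

/-- The second Griffiths inequality: the truncated correlations of two doubly positive operators
have the sign given by the product of their signs. -/
theorem truncated_nonneg (hW : IsOrthogonalFrame W c) {δ : ℂ} (ha : IsDoublePositive W ε a)
    (hb : IsDoublePositive W δ b) {E F : Matrix n n ℂ} (hE : E ⊗ₖ E ∈ positiveCone W)
    (hF : F ⊗ₖ F ∈ positiveCone W) :
    0 ≤ ε * δ * ((a * E * b * F).trace * (E * F).trace - (a * (E * F)).trace *
      (b * (F * E)).trace) := by
  have h := hW.trace_nonneg (hW.mul_mem (hW.mul_mem (hW.mul_mem ha.2 hE) hb.2) hF)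
  have key : (ε • (a ⊗ₖ (1 : Matrix n n ℂ) - (1 : Matrix n n ℂ) ⊗ₖ a) * E ⊗ₖ E *
      (δ • (b ⊗ₖ (1 : Matrix n n ℂ) - (1 : Matrix n n ℂ) ⊗ₖ b)) * F ⊗ₖ F).trace =
      2 * (ε * δ * ((a * E * b * F).trace * (E * F).trace - (a * (E * F)).trace *
      (b * (F * E)).trace)) := by
    have hcyc : (b * (F * E)).trace = (E * b * F).trace := by
      rw [← Matrix.mul_assoc, Matrix.trace_mul_comm, ← Matrix.mul_assoc]
    rw [hcyc]
    simp only [Matrix.smul_mul, Matrix.mul_smul, Matrix.trace_smul, Matrix.sub_mul, Matrix.mul_sub,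
      ← Matrix.mul_kronecker_mul, Matrix.one_mul, Matrix.mul_one, Matrix.trace_sub,
      Matrix.trace_kronecker, smul_eq_mul, Matrix.mul_assoc]
    ring
  rw [key] at h
  exact le_of_mul_le_mul_left (by simpa using h) (by norm_num : (0 : ℂ) < 2)

/-- The first Griffiths inequality. -/
theorem trace_mul_nonneg (hW : IsOrthogonalFrame W c) (ha : IsDoublePositive W ε a)
    {P : Matrix n n ℂ} (hP : P ⊗ₖ P ∈ positiveCone W) (hpos : 0 < P.trace) :
    0 ≤ (a * P).trace := by
  have h := hW.trace_nonneg (hW.mul_mem ha.1 hP)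
  have key : ((a ⊗ₖ (1 : Matrix n n ℂ) + (1 : Matrix n n ℂ) ⊗ₖ a) * P ⊗ₖ P).trace =
      (2 * P.trace) * (a * P).trace := by
    simp only [Matrix.add_mul, ← Matrix.mul_kronecker_mul, Matrix.one_mul, Matrix.trace_add,
      Matrix.trace_kronecker]
    ring
  rw [key] at h
  exact le_of_mul_le_mul_left (by simpa using h) (by positivity : (0 : ℂ) < 2 * P.trace)

end IsDoublePositive

variable [Fintype m] [DecidableEq m]

theorem boltzmann_kronecker_mem (hW : IsOrthogonalFrame W c) {H : Matrix n n ℂ}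
    (hH : -(H ⊗ₖ (1 : Matrix n n ℂ) + (1 : Matrix n n ℂ) ⊗ₖ H) ∈ positiveCone W) (E : ℝ)
    {t : ℝ} (ht : 0 ≤ t) : boltzmann H E t ⊗ₖ boltzmann H E t ∈ positiveCone W := by
  unfold boltzmann
  rw [Matrix.smul_kronecker, Matrix.kronecker_smul, smul_smul, ← exp_kronecker_sum]
  refine smul_mem_positiveCone ?_ (hW.exp_mem ?_)
  · rw [← Complex.ofReal_exp, ← Complex.ofReal_mul]
    exact Complex.zero_le_real.2 (by positivity)
  · convert smul_mem_positiveCone (Complex.zero_le_real.2 ht) hH using 1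
    rw [Matrix.smul_kronecker, Matrix.kronecker_smul, ← smul_add, smul_neg, neg_smul]

end Griffiths

/-! ### A positive basis for the doubled system -/

section DoubledFrame

/-- The first Pauli matrix. -/
def pauli1 : Matrix (Fin 2) (Fin 2) ℂ := !![0, 1; 1, 0]

/-- The second Pauli matrix. -/
def pauli2 : Matrix (Fin 2) (Fin 2) ℂ := !![0, -Complex.I; Complex.I, 0]

/-- An orthogonal basis of `ℂ² ⊗ ℂ²`: the columns are `|++⟩ + |--⟩`, `|+-⟩ + |-+⟩`,
`-i(|++⟩ - |--⟩)` and `i(|+-⟩ - |-+⟩)`. The phases are chosen so that the matrices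
`σ¹ ⊗ 1 + 1 ⊗ σ¹`, `σ¹ ⊗ 1 - 1 ⊗ σ¹`, `σ² ⊗ 1 + 1 ⊗ σ²` and `-(σ² ⊗ 1 - 1 ⊗ σ²)` have nonnegative
entries in this basis. -/
def bellBasis : Matrix (Fin 2 × Fin 2) (Fin 4) ℂ :=
  Matrix.of fun p => (![![![1, 0, -Complex.I, 0], ![0, 1, 0, Complex.I]],
    ![![0, 1, 0, -Complex.I], ![1, 0, Complex.I, 0]]] : Fin 2 → Fin 2 → Fin 4 → ℂ) p.1 p.2

theorem bellBasis_mul_conjTranspose : bellBasis * bellBasisᴴ = (2 : ℂ) • 1 := by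
  ext ⟨a, b⟩ ⟨c, d⟩
  fin_cases a <;> fin_cases b <;> fin_cases c <;> fin_cases d <;>
    simp [bellBasis, Matrix.mul_apply, Fin.sum_univ_four] <;> norm_num

theorem bellBasis_conjTranspose_mul : bellBasisᴴ * bellBasis = (2 : ℂ) • 1 := by
  ext a b
  fin_cases a <;> fin_cases b <;>
    simp [bellBasis, Matrix.mul_apply, Fintype.sum_prod_type] <;> norm_num

theorem pauli1_add_mem :
    pauli1 ⊗ₖ (1 : Matrix (Fin 2) (Fin 2) ℂ) + 1 ⊗ₖ pauli1 ∈ positiveCone bellBasis := by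
  intro a b
  fin_cases a <;> fin_cases b <;>
    simp [bellBasis, pauli1, Matrix.mul_apply, Fintype.sum_prod_type, Matrix.one_apply,
      add_mul] <;> norm_num

theorem pauli1_sub_mem :
    pauli1 ⊗ₖ (1 : Matrix (Fin 2) (Fin 2) ℂ) - 1 ⊗ₖ pauli1 ∈ positiveCone bellBasis := by
  intro a b
  fin_cases a <;> fin_cases b <;>
    simp [bellBasis, pauli1, Matrix.mul_apply, Fintype.sum_prod_type, Matrix.one_apply,
      add_mul] <;> norm_num

theorem pauli2_add_mem :
    pauli2 ⊗ₖ (1 : Matrix (Fin 2) (Fin 2) ℂ) + 1 ⊗ₖ pauli2 ∈ positiveCone bellBasis := by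
  intro a b
  fin_cases a <;> fin_cases b <;>
    simp [bellBasis, pauli2, Matrix.mul_apply, Fintype.sum_prod_type, Matrix.one_apply,
      add_mul] <;> norm_num

theorem neg_pauli2_sub_mem :
    (-1 : ℂ) • (pauli2 ⊗ₖ (1 : Matrix (Fin 2) (Fin 2) ℂ) - 1 ⊗ₖ pauli2) ∈
      positiveCone bellBasis := by
  intro a b
  fin_cases a <;> fin_cases b <;>
    simp [bellBasis, pauli2, Matrix.mul_apply, Fintype.sum_prod_type, Matrix.one_apply,
      add_mul] <;> norm_num

/-- The basis of `(ℂ² ⊗ ℂ²) ⊗ (ℂ² ⊗ ℂ²)` which pairs each of the two spins of one site with its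
copy in the doubled system. -/
def siteFrame : Matrix ((Fin 2 × Fin 2) × (Fin 2 × Fin 2)) (Fin 4 × Fin 4) ℂ :=
  (bellBasis ⊗ₖ bellBasis).submatrix (Equiv.prodProdProdComm _ _ _ _) id

theorem siteFrame_mul_conjTranspose : siteFrame * siteFrameᴴ = (4 : ℂ) • 1 := by
  unfold siteFrame
  rw [Matrix.conjTranspose_submatrix, Matrix.conjTranspose_kronecker]
  rw [← Matrix.submatrix_mul _ _ _ _ _ Function.bijective_id, ← Matrix.mul_kronecker_mul,
    bellBasis_mul_conjTranspose, Matrix.smul_kronecker, Matrix.kronecker_smul,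
    Matrix.one_kronecker_one, smul_smul]
  norm_num [Matrix.submatrix_smul]

theorem siteFrame_conj {X : Matrix ((Fin 2 × Fin 2) × (Fin 2 × Fin 2)) _ ℂ}
    {A B : Matrix (Fin 2 × Fin 2) (Fin 2 × Fin 2) ℂ}
    (hX : X = (A ⊗ₖ B).submatrix (Equiv.prodProdProdComm _ _ _ _)
      (Equiv.prodProdProdComm _ _ _ _)) :
    siteFrameᴴ * X * siteFrame = (bellBasisᴴ * A * bellBasis) ⊗ₖ (bellBasisᴴ * B * bellBasis) := by
  unfold siteFrame
  rw [hX, Matrix.conjTranspose_submatrix, Matrix.conjTranspose_kronecker,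
    ← Matrix.submatrix_mul _ _ _ _ _ (Equiv.bijective _),
    ← Matrix.submatrix_mul _ _ _ _ _ (Equiv.bijective _),
    ← Matrix.mul_kronecker_mul, ← Matrix.mul_kronecker_mul, Matrix.submatrix_id_id]

theorem siteFrame_conjTranspose_mul : siteFrameᴴ * siteFrame = (4 : ℂ) • 1 := by
  have h := siteFrame_conj (X := 1) (A := 1) (B := 1)
    (by rw [Matrix.one_kronecker_one, Matrix.submatrix_one_equiv])
  rw [Matrix.mul_one, Matrix.mul_one, bellBasis_conjTranspose_mul, Matrix.smul_kronecker,
    Matrix.kronecker_smul, Matrix.one_kronecker_one, smul_smul] at h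
  rw [h]; norm_num

theorem one_mem_positiveCone_bellBasis : (1 : Matrix _ _ ℂ) ∈ positiveCone bellBasis := by
  intro i j
  rw [Matrix.mul_one, bellBasis_conjTranspose_mul, Matrix.smul_apply, Matrix.one_apply]
  split_ifs <;> simp

theorem kronecker_mem_positiveCone_siteFrame
    {X : Matrix ((Fin 2 × Fin 2) × (Fin 2 × Fin 2)) _ ℂ}
    {A B : Matrix (Fin 2 × Fin 2) (Fin 2 × Fin 2) ℂ}
    (hX : X = (A ⊗ₖ B).submatrix (Equiv.prodProdProdComm _ _ _ _)
      (Equiv.prodProdProdComm _ _ _ _))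
    (hA : A ∈ positiveCone bellBasis) (hB : B ∈ positiveCone bellBasis) :
    X ∈ positiveCone siteFrame := by
  intro i j
  rw [siteFrame_conj hX]
  exact mul_nonneg (hA i.1 j.1) (hB i.2 j.2)

/-- Half the sum of `σ` on the two factors of `ℂ² ⊗ ℂ²`. -/
noncomputable def pairSpin (σ : Matrix (Fin 2) (Fin 2) ℂ) :
    Matrix (Fin 2 × Fin 2) (Fin 2 × Fin 2) ℂ :=
  (1 / 2 : ℂ) • (σ ⊗ₖ 1 + 1 ⊗ₖ σ)

theorem isDoublePositive_pairSpin {σ : Matrix (Fin 2) (Fin 2) ℂ} {ε : ℂ}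
    (h1 : σ ⊗ₖ (1 : Matrix (Fin 2) (Fin 2) ℂ) + 1 ⊗ₖ σ ∈ positiveCone bellBasis)
    (h2 : ε • (σ ⊗ₖ (1 : Matrix (Fin 2) (Fin 2) ℂ) - 1 ⊗ₖ σ) ∈ positiveCone bellBasis) :
    IsDoublePositive siteFrame ε (pairSpin σ) := by
  have hhalf : (0 : ℂ) ≤ 1 / 2 := by positivity
  have hone := one_mem_positiveCone_bellBasis
  unfold pairSpin
  refine IsDoublePositive.smul hhalf (IsDoublePositive.add ⟨?_, ?_⟩ ⟨?_, ?_⟩)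
  · refine kronecker_mem_positiveCone_siteFrame ?_ h1 hone
    ext ⟨⟨a, b⟩, a', b'⟩ ⟨⟨c, d⟩, c', d'⟩
    simp [Matrix.one_apply, Prod.ext_iff, ite_and]
    split_ifs <;> simp_all
  · refine kronecker_mem_positiveCone_siteFrame ?_ h2 hone
    ext ⟨⟨a, b⟩, a', b'⟩ ⟨⟨c, d⟩, c', d'⟩
    simp [Matrix.one_apply, Prod.ext_iff, ite_and]
    split_ifs <;> simp_all
  · refine kronecker_mem_positiveCone_siteFrame ?_ hone h1
    ext ⟨⟨a, b⟩, a', b'⟩ ⟨⟨c, d⟩, c', d'⟩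
    simp [Matrix.one_apply, Prod.ext_iff, ite_and]
    split_ifs <;> simp_all
  · refine kronecker_mem_positiveCone_siteFrame ?_ hone h2
    ext ⟨⟨a, b⟩, a', b'⟩ ⟨⟨c, d⟩, c', d'⟩
    simp [Matrix.one_apply, Prod.ext_iff, ite_and]
    split_ifs <;> simp_all

variable {Λ : Type*} [Fintype Λ] [DecidableEq Λ]

section General
variable {κ μ : Type*}

/-- The product basis of the doubled space of all sites, built from a basis of the doubled space
of a single site. -/
def productFrame (Λ : Type*) [Fintype Λ] (w : Matrix (κ × κ) μ ℂ) :
    Matrix ((Λ → κ) × (Λ → κ)) (Λ → μ) ℂ :=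
  (piTensor fun _ : Λ => w).submatrix (Equiv.arrowProdEquivProdArrow Λ _ _).symm id

theorem productFrame_conj [Fintype κ] (w : Matrix (κ × κ) μ ℂ) (M : Λ → Matrix (κ × κ) (κ × κ) ℂ) :
    (productFrame Λ w)ᴴ * (piTensor M).submatrix (Equiv.arrowProdEquivProdArrow Λ _ _).symm
      (Equiv.arrowProdEquivProdArrow Λ _ _).symm * productFrame Λ w =
    piTensor fun x => wᴴ * M x * w := by
  unfold productFrame
  rw [Matrix.conjTranspose_submatrix, ← Matrix.submatrix_mul _ _ _ _ _ (Equiv.bijective _),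
    ← Matrix.submatrix_mul _ _ _ _ _ (Equiv.bijective _), piTensor_conjTranspose, piTensor_mul,
    piTensor_mul, Matrix.submatrix_id_id]

theorem siteEmbed_kronecker_one [DecidableEq κ] (x : Λ) (a : Matrix κ κ ℂ) :
    siteEmbed x a ⊗ₖ (1 : Matrix (Λ → κ) (Λ → κ) ℂ) =
      (siteEmbed x (a ⊗ₖ (1 : Matrix κ κ ℂ))).submatrix
        (Equiv.arrowProdEquivProdArrow Λ _ _).symm (Equiv.arrowProdEquivProdArrow Λ _ _).symm := by
  ext ⟨σ, σ'⟩ ⟨τ, τ'⟩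
  rw [← piTensor_one]
  simp only [siteEmbed, Matrix.kroneckerMap_apply, piTensor_apply, Matrix.submatrix_apply,
    ← Finset.prod_mul_distrib]
  refine Finset.prod_congr rfl fun y _ => ?_
  split_ifs
  · rfl
  · rw [← Matrix.one_kronecker_one]; rfl

theorem one_kronecker_siteEmbed [DecidableEq κ] (x : Λ) (a : Matrix κ κ ℂ) :
    (1 : Matrix (Λ → κ) (Λ → κ) ℂ) ⊗ₖ siteEmbed x a =
      (siteEmbed x ((1 : Matrix κ κ ℂ) ⊗ₖ a)).submatrix
        (Equiv.arrowProdEquivProdArrow Λ _ _).symm (Equiv.arrowProdEquivProdArrow Λ _ _).symm := by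
  ext ⟨σ, σ'⟩ ⟨τ, τ'⟩
  rw [← piTensor_one]
  simp only [siteEmbed, Matrix.kroneckerMap_apply, piTensor_apply, Matrix.submatrix_apply,
    ← Finset.prod_mul_distrib]
  refine Finset.prod_congr rfl fun y _ => ?_
  split_ifs
  · rfl
  · rw [← Matrix.one_kronecker_one]; rfl

variable [Fintype κ] [DecidableEq κ] [Fintype μ] [DecidableEq μ]

theorem isOrthogonalFrame_productFrame {w : Matrix (κ × κ) μ ℂ} {c : ℝ}
    (hw : IsOrthogonalFrame w c) :
    IsOrthogonalFrame (productFrame Λ w) (c ^ Fintype.card Λ) := by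
  refine ⟨pow_pos hw.pos _, ?_, ?_⟩
  · unfold productFrame
    rw [Matrix.conjTranspose_submatrix, ← Matrix.submatrix_mul _ _ _ _ _ Function.bijective_id,
      piTensor_conjTranspose, piTensor_mul]
    simp only [hw.mul_conjTranspose]
    rw [piTensor_const_smul, piTensor_one]
    ext i j
    simp [Matrix.one_apply]
  · have h := productFrame_conj (Λ := Λ) w fun _ => 1
    rw [piTensor_one, Matrix.submatrix_one_equiv, Matrix.mul_one] at h
    rw [h]
    simp only [Matrix.mul_one, hw.conjTranspose_mul]
    rw [piTensor_const_smul, piTensor_one]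
    push_cast; rfl

theorem siteEmbed_mem_positiveCone {w : Matrix (κ × κ) μ ℂ} {c : ℝ}
    (hw : IsOrthogonalFrame w c) (x : Λ) {M : Matrix (κ × κ) (κ × κ) ℂ}
    (hM : M ∈ positiveCone w) :
    (siteEmbed x M).submatrix (Equiv.arrowProdEquivProdArrow Λ _ _).symm
      (Equiv.arrowProdEquivProdArrow Λ _ _).symm ∈ positiveCone (productFrame Λ w) := by
  intro i j
  unfold siteEmbed
  rw [productFrame_conj, piTensor_apply]
  refine Finset.prod_nonneg fun y _ => ?_
  split_ifs
  · exact hM _ _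
  · exact hw.one_mem _ _

theorem IsDoublePositive.siteEmbed {w : Matrix (κ × κ) μ ℂ} {c : ℝ}
    (hw : IsOrthogonalFrame w c) (x : Λ) {ε : ℂ} {a : Matrix κ κ ℂ}
    (ha : IsDoublePositive w ε a) :
    IsDoublePositive (productFrame Λ w) ε (siteEmbed x a) := by
  refine ⟨?_, ?_⟩
  · convert siteEmbed_mem_positiveCone (Λ := Λ) hw x ha.1 using 1
    rw [siteEmbed_kronecker_one, one_kronecker_siteEmbed, siteEmbed_add]
    rfl
  · convert siteEmbed_mem_positiveCone (Λ := Λ) hw x ha.2 using 1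
    rw [siteEmbed_kronecker_one, one_kronecker_siteEmbed, siteEmbed_smul, siteEmbed_sub]
    rfl

theorem IsDoublePositive.regionProd {w : Matrix (κ × κ) μ ℂ} {c : ℝ}
    (hw : IsOrthogonalFrame w c) {ε : ℂ} (hε : ε * ε = 1) {a : Matrix κ κ ℂ}
    (ha : IsDoublePositive w ε a) (A : Finset Λ) :
    IsDoublePositive (productFrame Λ w) ε (regionProd a A) := by
  have hW := isOrthogonalFrame_productFrame (Λ := Λ) hw
  induction A using Finset.induction_on with
  | empty => rw [regionProd_empty]; exact IsDoublePositive.one hW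
  | insert x A hx ih =>
    rw [regionProd_insert a hx]
    exact IsDoublePositive.mul hW hε (ha.siteEmbed hw x) ih

end General

theorem isOrthogonalFrame_siteFrame : IsOrthogonalFrame siteFrame 4 :=
  ⟨by norm_num, by simpa using siteFrame_mul_conjTranspose,
    by simpa using siteFrame_conjTranspose_mul⟩

end DoubledFrame

/-! ### Spin 1 as the triplet states of two spins 1/2 -/

section Triplet

/-- The isometry from `ℂ³` onto the symmetric subspace (the triplets) of `ℂ² ⊗ ℂ²`. -/
noncomputable def tripletIso : Matrix (Fin 2 × Fin 2) (Fin 3) ℂ :=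
  Matrix.of fun p => (![![![1, 0, 0], ![0, ((1 / Real.sqrt 2 : ℝ) : ℂ), 0]],
    ![![0, ((1 / Real.sqrt 2 : ℝ) : ℂ), 0], ![0, 0, 1]]] : Fin 2 → Fin 2 → Fin 3 → ℂ) p.1 p.2

set_option linter.unusedSimpArgs false in
theorem tripletIso_conjTranspose_mul : tripletIsoᴴ * tripletIso = 1 := by
  have h := spinOne_factor_sq
  unfold tripletIso
  generalize hc : ((1 / Real.sqrt 2 : ℝ) : ℂ) = c at h ⊢
  have hs : (starRingEnd ℂ) c = c := by rw [← hc]; exact Complex.conj_ofReal _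
  ext a b
  fin_cases a <;> fin_cases b <;>
    simp [Matrix.mul_apply, Fintype.sum_prod_type, Matrix.one_apply, hs, h]
  norm_num

set_option linter.unusedSimpArgs false in
theorem pairSpin_pauli1 : pairSpin pauli1 = tripletIso * spinOne1 * tripletIsoᴴ := by
  have h := spinOne_factor_sq
  unfold tripletIso pairSpin pauli1 spinOne1
  generalize hc : ((1 / Real.sqrt 2 : ℝ) : ℂ) = c at h ⊢
  have hs : (starRingEnd ℂ) c = c := by rw [← hc]; exact Complex.conj_ofReal _
  ext ⟨a, b⟩ ⟨a', b'⟩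
  fin_cases a <;> fin_cases b <;> fin_cases a' <;> fin_cases b' <;>
    simp [Matrix.mul_apply, Fin.sum_univ_three, Matrix.one_apply, hs, h]

set_option linter.unusedSimpArgs false in
theorem pairSpin_pauli2 : pairSpin pauli2 = tripletIso * spinOne2 * tripletIsoᴴ := by
  have h := spinOne_factor_sq
  unfold tripletIso pairSpin pauli2 spinOne2
  generalize hc : ((1 / Real.sqrt 2 : ℝ) : ℂ) = c at h ⊢
  have hs : (starRingEnd ℂ) c = c := by rw [← hc]; exact Complex.conj_ofReal _
  ext ⟨a, b⟩ ⟨a', b'⟩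
  fin_cases a <;> fin_cases b <;> fin_cases a' <;> fin_cases b' <;>
    simp [Matrix.mul_apply, Fin.sum_univ_three, Matrix.one_apply, hs, h] <;> grind

/-- The orthogonal projection onto the triplets. -/
noncomputable def tripletProj : Matrix (Fin 2 × Fin 2) (Fin 2 × Fin 2) ℂ :=
  tripletIso * tripletIsoᴴ

/-- The local facts about a pair of spin operators `R`, `R'` on `ℂ² ⊗ ℂ²` (in either order) that
force a coupled site into the triplet states. The operator `R` vanishes on the singlet, whose
projection is `s`. Both operators have vanishing expectation in the triplet state `φ`, and `R φ` is
a unit vector orthogonal to `R' φ`. Finally `1 - R²` is the projection onto the kernel of `R`, within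
which `R'` has no matrix elements. -/
structure IsTransversePair {κ : Type*} [Fintype κ] [DecidableEq κ] (s : Matrix κ κ ℂ)
    (φ : Matrix κ Unit ℂ) (R R' : Matrix κ κ ℂ) : Prop where
  isHermitian : R.IsHermitian
  mul_singlet : R * s = 0
  singlet_mul : s * R = 0
  expectation : φᴴ * R * φ = 0
  expectation' : φᴴ * R' * φ = 0
  expectation_sq : φᴴ * R * R * φ = 1
  expectation_mul : φᴴ * R * R' * φ = 0
  cube : R * R * R = R
  sandwich : (1 - R * R) * R' * (1 - R * R) = 0

/-- The triplet state annihilated by the third spin operator. -/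
noncomputable def planarState : Matrix (Fin 2 × Fin 2) Unit ℂ :=
  tripletIso * Matrix.of fun (i : Fin 3) (_ : Unit) => if i = 1 then (1 : ℂ) else 0

theorem isTransversePair_of_spinOne {S S' : Matrix (Fin 3) (Fin 3) ℂ} (hS : S.IsHermitian)
    (h1 : S 1 1 = 0) (h2 : S' 1 1 = 0) (h3 : (S * S) 1 1 = 1) (h4 : (S * S') 1 1 = 0)
    (h5 : S * S * S = S) (h6 : (1 - S * S) * S' * (1 - S * S) = 0) :
    IsTransversePair (1 - tripletProj) planarState (tripletIso * S * tripletIsoᴴ)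
      (tripletIso * S' * tripletIsoᴴ) := by
  have hv := tripletIso_conjTranspose_mul
  have key : ∀ X : Matrix (Fin 3) (Fin 3) ℂ,
      planarStateᴴ * (tripletIso * X * tripletIsoᴴ) * planarState = Matrix.of fun _ _ => X 1 1 := by
    intro X
    unfold planarState
    rw [Matrix.conjTranspose_mul]
    generalize tripletIso = v at *
    calc _ = (Matrix.of fun i (_ : Unit) => if i = (1 : Fin 3) then (1 : ℂ) else 0)ᴴ *
          ((vᴴ * v) * X * (vᴴ * v)) *
          (Matrix.of fun i (_ : Unit) => if i = (1 : Fin 3) then (1 : ℂ) else 0) := by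
          simp only [Matrix.mul_assoc]
      _ = _ := by
          rw [hv, Matrix.one_mul, Matrix.mul_one]
          ext i j
          simp [Matrix.mul_apply]
  have hmul : ∀ X Y : Matrix (Fin 3) (Fin 3) ℂ, (tripletIso * X * tripletIsoᴴ) *
      (tripletIso * Y * tripletIsoᴴ) = tripletIso * (X * Y) * tripletIsoᴴ := by
    intro X Y
    generalize tripletIso = v at *
    calc _ = v * X * (vᴴ * v) * Y * vᴴ := by simp only [Matrix.mul_assoc]
      _ = _ := by rw [hv, Matrix.mul_one]; simp only [Matrix.mul_assoc]
  have hr : tripletIso * S * tripletIsoᴴ * tripletProj = tripletIso * S * tripletIsoᴴ := by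
    have := hmul S 1
    rwa [Matrix.mul_one, Matrix.mul_one] at this
  have hl : tripletProj * (tripletIso * S * tripletIsoᴴ) = tripletIso * S * tripletIsoᴴ := by
    have := hmul 1 S
    rwa [Matrix.mul_one, Matrix.one_mul] at this
  have hone : (1 : Matrix (Fin 2 × Fin 2) (Fin 2 × Fin 2) ℂ) - tripletIso * (S * S) * tripletIsoᴴ
      = (1 - tripletProj) + tripletIso * (1 - S * S) * tripletIsoᴴ := by
    rw [Matrix.mul_sub, Matrix.sub_mul, Matrix.mul_one, tripletProj]; abel
  have hv' : tripletIsoᴴ * (1 - tripletProj) = 0 := by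
    rw [Matrix.mul_sub, Matrix.mul_one, tripletProj, ← Matrix.mul_assoc, hv, Matrix.one_mul,
      sub_self]
  have hv'' : (1 - tripletProj) * tripletIso = 0 := by
    rw [Matrix.sub_mul, Matrix.one_mul, tripletProj, Matrix.mul_assoc, hv, Matrix.mul_one,
      sub_self]
  refine ⟨?_, ?_, ?_, ?_, ?_, ?_, ?_, ?_, ?_⟩
  · exact Matrix.isHermitian_mul_mul_conjTranspose tripletIso hS
  · rw [Matrix.mul_sub, hr, Matrix.mul_one, sub_self]
  · rw [Matrix.sub_mul, hl, Matrix.one_mul, sub_self]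
  · rw [key, h1]; rfl
  · rw [key, h2]; rfl
  · rw [Matrix.mul_assoc planarStateᴴ, hmul, key, h3]; ext i j; simp
  · rw [Matrix.mul_assoc planarStateᴴ, hmul, key, h4]; rfl
  · rw [hmul, hmul, h5]
  · rw [hmul, hone, Matrix.add_mul, Matrix.mul_assoc tripletIso S', ← Matrix.mul_assoc _ tripletIso,
      hv'', Matrix.zero_mul, zero_add, ← Matrix.mul_assoc tripletIso S', hmul, Matrix.mul_add,
      Matrix.mul_assoc _ _ (1 - tripletProj), hv', Matrix.mul_zero, zero_add, hmul, h6]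
    simp

theorem spinOne1_mul_self : spinOne1 * spinOne1 =
    (1 / 2 : ℂ) • !![1, 0, 1; 0, 2, 0; 1, 0, 1] := by
  unfold spinOne1
  rw [Matrix.smul_mul, Matrix.mul_smul, smul_smul, spinOne_factor_sq]
  congr 1
  ext i j
  fin_cases i <;> fin_cases j <;> simp [Matrix.mul_apply, Fin.sum_univ_three]
  norm_num

theorem spinOne2_mul_self : spinOne2 * spinOne2 =
    (1 / 2 : ℂ) • !![1, 0, -1; 0, 2, 0; -1, 0, 1] := by
  unfold spinOne2
  rw [Matrix.smul_mul, Matrix.mul_smul, smul_smul, spinOne_factor_sq]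
  congr 1
  ext i j
  fin_cases i <;> fin_cases j <;> simp [Matrix.mul_apply, Fin.sum_univ_three]
  norm_num

theorem one_sub_spinOne1_mul_self : 1 - spinOne1 * spinOne1 =
    (1 / 2 : ℂ) • !![1, 0, -1; 0, 0, 0; -1, 0, 1] := by
  rw [spinOne1_mul_self]
  ext i j
  fin_cases i <;> fin_cases j <;> norm_num [Matrix.one_apply]

theorem one_sub_spinOne2_mul_self : 1 - spinOne2 * spinOne2 =
    (1 / 2 : ℂ) • !![1, 0, 1; 0, 0, 0; 1, 0, 1] := by
  rw [spinOne2_mul_self]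
  ext i j
  fin_cases i <;> fin_cases j <;> norm_num [Matrix.one_apply]

theorem isTransversePair_pairSpin1 :
    IsTransversePair (1 - tripletProj) planarState (pairSpin pauli1) (pairSpin pauli2) := by
  rw [pairSpin_pauli1, pairSpin_pauli2]
  refine isTransversePair_of_spinOne spinOne_relations.1 ?_ ?_ ?_ ?_ ?_ ?_
  · simp [spinOne1]
  · simp [spinOne2]
  · simp [spinOne1_mul_self]
  · simp [spinOne1, spinOne2, Matrix.mul_apply, Fin.sum_univ_three]
  · rw [spinOne1_mul_self, spinOne1]
    ext i j
    fin_cases i <;> fin_cases j <;> simp [Matrix.mul_apply, Fin.sum_univ_three] <;> ring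
  · rw [one_sub_spinOne1_mul_self, spinOne2]
    ext i j
    fin_cases i <;> fin_cases j <;> simp [Matrix.mul_apply, Fin.sum_univ_three]

theorem isTransversePair_pairSpin2 :
    IsTransversePair (1 - tripletProj) planarState (pairSpin pauli2) (pairSpin pauli1) := by
  rw [pairSpin_pauli1, pairSpin_pauli2]
  refine isTransversePair_of_spinOne spinOne_relations.2.1 ?_ ?_ ?_ ?_ ?_ ?_
  · simp [spinOne2]
  · simp [spinOne1]
  · simp [spinOne2_mul_self]
  · simp [spinOne1, spinOne2, Matrix.mul_apply, Fin.sum_univ_three]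
  · rw [spinOne2_mul_self, spinOne2]
    ext i j
    fin_cases i <;> fin_cases j <;> simp [Matrix.mul_apply, Fin.sum_univ_three] <;> ring
  · rw [one_sub_spinOne2_mul_self, spinOne1]
    ext i j
    fin_cases i <;> fin_cases j <;> simp [Matrix.mul_apply, Fin.sum_univ_three]

theorem trace_tripletProj : tripletProj.trace = 3 := by
  rw [tripletProj, Matrix.trace_mul_comm, tripletIso_conjTranspose_mul]
  simp

theorem tripletProj_mul_self : tripletProj * tripletProj = tripletProj := by
  unfold tripletProj
  rw [Matrix.mul_assoc, ← Matrix.mul_assoc tripletIsoᴴ, tripletIso_conjTranspose_mul,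
    Matrix.one_mul]

theorem tripletProj_mul (S : Matrix (Fin 3) (Fin 3) ℂ) :
    tripletProj * (tripletIso * S * tripletIsoᴴ) = tripletIso * S * tripletIsoᴴ := by
  unfold tripletProj
  rw [← Matrix.mul_assoc, ← Matrix.mul_assoc, Matrix.mul_assoc tripletIso,
    tripletIso_conjTranspose_mul, Matrix.mul_one]

theorem mul_tripletProj (S : Matrix (Fin 3) (Fin 3) ℂ) :
    tripletIso * S * tripletIsoᴴ * tripletProj = tripletIso * S * tripletIsoᴴ := by
  unfold tripletProj
  rw [← Matrix.mul_assoc, Matrix.mul_assoc _ tripletIsoᴴ tripletIso,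
    tripletIso_conjTranspose_mul, Matrix.mul_one]

end Triplet

/-! ### Ground states are triplets at coupled sites -/

section Strictness
variable {Λ κ : Type*} [Fintype Λ] [DecidableEq Λ] [DecidableEq κ]

/-- The hamiltonian `-∑_A (J_A ∏_{x ∈ A} R_x + J'_A ∏_{x ∈ A} R'_x)`. -/
noncomputable def pairHamiltonian (R R' : Matrix κ κ ℂ) (J J' : Finset Λ → ℝ) :
    Matrix (Λ → κ) (Λ → κ) ℂ :=
  -∑ A : Finset Λ, ((J A : ℂ) • regionProd R A + (J' A : ℂ) • regionProd R' A)

theorem pairHamiltonian_swap (R R' : Matrix κ κ ℂ) (J J' : Finset Λ → ℝ) :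
    pairHamiltonian R R' J J' = pairHamiltonian R' R J' J := by
  simp only [pairHamiltonian, add_comm]

theorem pairHamiltonian_isHermitian {R R' : Matrix κ κ ℂ} (hR : R.IsHermitian)
    (hR' : R'.IsHermitian) (J J' : Finset Λ → ℝ) : (pairHamiltonian R R' J J').IsHermitian := by
  unfold Matrix.IsHermitian pairHamiltonian
  simp [Matrix.conjTranspose_sum, Matrix.conjTranspose_smul, regionProd_conjTranspose,
    hR.eq, hR'.eq]

variable [Fintype κ]

/-- The couplings with all terms that involve the site `x` removed. -/
def dropSite (x : Λ) (J : Finset Λ → ℝ) (A : Finset Λ) : ℝ := if x ∈ A then 0 else J A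

/-- The operator that multiplies `R_x` in the sum of the `J_A ∏_{y ∈ A} R_y`. -/
noncomputable def siteField (x : Λ) (R : Matrix κ κ ℂ) (J : Finset Λ → ℝ) :
    Matrix (Λ → κ) (Λ → κ) ℂ :=
  ∑ A : Finset Λ, if x ∈ A then (J A : ℂ) • regionProd R (A.erase x) else 0

theorem siteField_actsAwayFrom (x : Λ) (R : Matrix κ κ ℂ) (J : Finset Λ → ℝ) :
    ActsAwayFrom x (siteField x R J) := by
  refine ActsAwayFrom.sum fun A _ => ?_
  split_ifs
  · exact (regionProd_actsAwayFrom R (Finset.notMem_erase x A)).smul _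
  · exact fun M => Commute.zero_right _

theorem sum_regionProd_eq (x : Λ) (R : Matrix κ κ ℂ) (J : Finset Λ → ℝ) :
    ∑ A : Finset Λ, (J A : ℂ) • regionProd R A =
      ∑ A : Finset Λ, (dropSite x J A : ℂ) • regionProd R A +
        siteEmbed x R * siteField x R J := by
  rw [siteField, Finset.mul_sum, ← Finset.sum_add_distrib]
  refine Finset.sum_congr rfl fun A _ => ?_
  by_cases hx : x ∈ A
  · conv_lhs => rw [← Finset.insert_erase hx, regionProd_insert R (Finset.notMem_erase x A)]
    simp [hx, dropSite]
  · simp [hx, dropSite]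

theorem pairHamiltonian_eq (x : Λ) (R R' : Matrix κ κ ℂ) (J J' : Finset Λ → ℝ) :
    pairHamiltonian R R' J J' = pairHamiltonian R R' (dropSite x J) (dropSite x J') -
      siteEmbed x R * siteField x R J - siteEmbed x R' * siteField x R' J' := by
  unfold pairHamiltonian
  rw [Finset.sum_add_distrib, Finset.sum_add_distrib, sum_regionProd_eq x R J,
    sum_regionProd_eq x R' J']
  abel

theorem pairHamiltonian_actsAwayFrom {x : Λ} (R R' : Matrix κ κ ℂ) {J J' : Finset Λ → ℝ}
    (hJ : ∀ A, x ∈ A → J A = 0) (hJ' : ∀ A, x ∈ A → J' A = 0) :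
    ActsAwayFrom x (pairHamiltonian R R' J J') := by
  refine ActsAwayFrom.neg (ActsAwayFrom.sum fun A _ => ?_)
  by_cases hx : x ∈ A
  · intro M
    simp [hJ A hx, hJ' A hx]
  · exact ((regionProd_actsAwayFrom R hx).smul _).add ((regionProd_actsAwayFrom R' hx).smul _)

theorem dropSite_actsAwayFrom (x : Λ) (R R' : Matrix κ κ ℂ) (J J' : Finset Λ → ℝ) :
    ActsAwayFrom x (pairHamiltonian R R' (dropSite x J) (dropSite x J')) :=
  pairHamiltonian_actsAwayFrom R R' (fun _ h => if_pos h) fun _ h => if_pos h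

/-- The matrix `|φ⟩⟨j|`. -/
def ketBra (φ : Matrix κ Unit ℂ) (j : κ) : Matrix κ κ ℂ :=
  φ * Matrix.of fun (_ : Unit) (k : κ) => if k = j then (1 : ℂ) else 0

theorem ketBra_conj (φ : Matrix κ Unit ℂ) (j : κ) (M : Matrix κ κ ℂ) :
    (ketBra φ j)ᴴ * M * ketBra φ j = (φᴴ * M * φ) () () • Matrix.single j j 1 := by
  have h : ∀ Z : Matrix Unit Unit ℂ,
      (Matrix.of fun (_ : Unit) (k : κ) => if k = j then (1 : ℂ) else 0)ᴴ * Z *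
        (Matrix.of fun (_ : Unit) (k : κ) => if k = j then (1 : ℂ) else 0) =
      Z () () • Matrix.single j j 1 := by
    intro Z
    ext a b
    rw [Matrix.smul_apply, Matrix.single_apply]
    by_cases ha : a = j <;> by_cases hb : b = j <;>
      simp [Matrix.mul_apply, ha, hb, eq_comm (a := j)]
  rw [← h, ketBra, Matrix.conjTranspose_mul]
  simp only [Matrix.mul_assoc]

theorem eq_zero_of_single_mul {x : Λ} {X : Matrix (Λ → κ) (Λ → κ) ℂ}
    (h : ∀ j, siteEmbed x (Matrix.single j j (1 : ℂ)) * X = 0) : X = 0 := by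
  have h1 : ∑ k : κ, Matrix.single k k (1 : ℂ) = 1 := by
    ext a b
    simp [Matrix.sum_apply, Matrix.single_apply, Matrix.one_apply, ite_and]
  rw [← Matrix.one_mul X, ← siteEmbed_one x, ← h1, siteEmbed_sum, Finset.sum_mul]
  exact Finset.sum_eq_zero fun j _ => h j

section OneSite
variable {s : Matrix κ κ ℂ} {φ : Matrix κ Unit ℂ} {R R' : Matrix κ κ ℂ} {x : Λ}
  {H H₀ K K' P : Matrix (Λ → κ) (Λ → κ) ℂ} {E : ℝ}

/-- Suppose that the vectors `X` have the ground energy of `H` for the part `H₀` of `H` without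
the site `x`. Placing the state `φ` at `x` gives trial vectors with the ground energy of `H`, as
`R` and `R'` have no expectation in `φ`. -/
theorem IsTransversePair.trial_eigen (hp : IsTransversePair s φ R R')
    (hH : H = H₀ - siteEmbed x R * K - siteEmbed x R' * K') (hH₀ : ActsAwayFrom x H₀)
    (hK : ActsAwayFrom x K) (hK' : ActsAwayFrom x K') (hP : IsGroundProjection H E P)
    {X : Matrix (Λ → κ) (Λ → κ) ℂ} (hX : H₀ * X = (E : ℂ) • X) (j : κ) :
    H * (siteEmbed x (ketBra φ j) * X) = (E : ℂ) • (siteEmbed x (ketBra φ j) * X) ∧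
    siteEmbed x (R * ketBra φ j) * (K * X) + siteEmbed x (R' * ketBra φ j) * (K' * X) = 0 := by
  have h1 : H * (siteEmbed x (ketBra φ j) * X) = (E : ℂ) • (siteEmbed x (ketBra φ j) * X) -
      siteEmbed x (R * ketBra φ j) * (K * X) - siteEmbed x (R' * ketBra φ j) * (K' * X) := by
    have e1 := (hH₀ (ketBra φ j)).eq
    have e2 := (hK (ketBra φ j)).eq
    have e3 := (hK' (ketBra φ j)).eq
    rw [hH, siteEmbed_mul, siteEmbed_mul]
    generalize siteEmbed x (ketBra φ j) = G at *
    calc _ = H₀ * G * X - siteEmbed x R * (K * G) * X - siteEmbed x R' * (K' * G) * X := by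
          simp only [Matrix.sub_mul, Matrix.mul_assoc]
      _ = G * (H₀ * X) - siteEmbed x R * (G * K) * X - siteEmbed x R' * (G * K') * X := by
          rw [e2, e3, ← e1, Matrix.mul_assoc G]
      _ = _ := by rw [hX, Matrix.mul_smul]; simp only [Matrix.mul_assoc]
  have h2 : H * (siteEmbed x (ketBra φ j) * X) = (E : ℂ) • (siteEmbed x (ketBra φ j) * X) := by
    refine hP.eigen_of_trial ?_
    rw [Matrix.sub_mul, h1, Matrix.smul_mul, Matrix.one_mul, Matrix.conjTranspose_mul,
      siteEmbed_conjTranspose]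
    have e1 : siteEmbed x (ketBra φ j)ᴴ * siteEmbed x (R * ketBra φ j) = 0 := by
      rw [← siteEmbed_mul, ← Matrix.mul_assoc, ketBra_conj, hp.expectation]
      simp [siteEmbed_zero]
    have e2 : siteEmbed x (ketBra φ j)ᴴ * siteEmbed x (R' * ketBra φ j) = 0 := by
      rw [← siteEmbed_mul, ← Matrix.mul_assoc, ketBra_conj, hp.expectation']
      simp [siteEmbed_zero]
    generalize siteEmbed x (ketBra φ j)ᴴ = G' at *
    generalize siteEmbed x (R * ketBra φ j) = a at *
    generalize siteEmbed x (R' * ketBra φ j) = b at *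
    calc _ = -(Xᴴ * (G' * a) * (K * X)) - Xᴴ * (G' * b) * (K' * X) := by
          simp only [Matrix.mul_assoc, Matrix.mul_sub]; abel
      _ = 0 := by rw [e1, e2]; simp
  refine ⟨h2, ?_⟩
  rw [h2, sub_sub] at h1
  exact sub_eq_self.1 h1.symm

/-- In the situation of `IsTransversePair.trial_eigen` the variational principle forces the field
acting on the site `x` to vanish on `X`. -/
theorem IsTransversePair.field_mul_eq_zero (hp : IsTransversePair s φ R R')
    (hH : H = H₀ - siteEmbed x R * K - siteEmbed x R' * K') (hH₀ : ActsAwayFrom x H₀)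
    (hK : ActsAwayFrom x K) (hK' : ActsAwayFrom x K') (hP : IsGroundProjection H E P)
    {X : Matrix (Λ → κ) (Λ → κ) ℂ} (hX : H₀ * X = (E : ℂ) • X) : K * X = 0 := by
  refine eq_zero_of_single_mul (x := x) fun j => ?_
  have h := (hp.trial_eigen hH hH₀ hK hK' hP hX j).2
  have h1 := congrArg (fun Z => siteEmbed x ((ketBra φ j)ᴴ * R) * Z) h
  simp only [Matrix.mul_add, Matrix.mul_zero, ← Matrix.mul_assoc, ← siteEmbed_mul] at h1
  rw [Matrix.mul_assoc _ R R, Matrix.mul_assoc _ R R', ketBra_conj, ketBra_conj,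
    ← Matrix.mul_assoc, ← Matrix.mul_assoc, hp.expectation_sq, hp.expectation_mul] at h1
  simpa [siteEmbed_zero, Matrix.mul_assoc] using h1

/-- The operator `R_x` does not annihilate the ground states. -/
theorem IsTransversePair.siteEmbed_mul_ne_zero (hp : IsTransversePair s φ R R')
    (hH : H = H₀ - siteEmbed x R * K - siteEmbed x R' * K') (hH₀ : ActsAwayFrom x H₀)
    (hK : ActsAwayFrom x K) (hK' : ActsAwayFrom x K') (hP : IsGroundProjection H E P) :
    siteEmbed x R * P ≠ 0 := by
  intro h0
  -- The ground states lie in the kernel of `R_x`, where `R'_x` has no matrix elements.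
  have hQP : siteEmbed x (1 - R * R) * P = P := by
    rw [siteEmbed_sub, siteEmbed_one, siteEmbed_mul, Matrix.sub_mul, Matrix.mul_assoc, h0]
    simp
  have hQR : siteEmbed x (1 - R * R) * siteEmbed x R = 0 := by
    rw [← siteEmbed_mul, Matrix.sub_mul, hp.cube, Matrix.one_mul, sub_self, siteEmbed_zero]
  have hQR' : siteEmbed x (1 - R * R) * siteEmbed x R' * siteEmbed x (1 - R * R) = 0 := by
    rw [← siteEmbed_mul, ← siteEmbed_mul, hp.sandwich, siteEmbed_zero]
  have e1 := (hH₀ (1 - R * R)).eq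
  have e2 := (hK' (1 - R * R)).eq
  have hX : H₀ * P = (E : ℂ) • P := by
    generalize siteEmbed x (1 - R * R) = G at *
    calc H₀ * P = H₀ * G * P - G * siteEmbed x R * K * P - G * siteEmbed x R' * G * K' * P := by
          rw [hQR, hQR', Matrix.mul_assoc H₀, hQP]; simp
      _ = G * H₀ * P - G * siteEmbed x R * K * P - G * siteEmbed x R' * (K' * G) * P := by
          rw [← e1, ← e2]; simp only [Matrix.mul_assoc]
      _ = G * (H * P) := by
          rw [hH]
          simp only [Matrix.mul_assoc, Matrix.sub_mul, Matrix.mul_sub, hQP]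
      _ = (E : ℂ) • P := by rw [hP.mul_eq, Matrix.mul_smul, hQP]
  refine hP.ne_zero (eq_zero_of_single_mul (x := x) fun j => ?_)
  have h1 := hP.mul_of_eigen (hp.trial_eigen hH hH₀ hK hK' hP hX j).1
  have h2 : siteEmbed x (R * ketBra φ j) * P = 0 := by
    rw [siteEmbed_mul, Matrix.mul_assoc, ← h1, ← Matrix.mul_assoc, h0, Matrix.zero_mul]
  have h3 := congrArg (fun Z => siteEmbed x ((ketBra φ j)ᴴ * R) * Z) h2
  simp only [Matrix.mul_zero, ← Matrix.mul_assoc, ← siteEmbed_mul] at h3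
  rw [Matrix.mul_assoc _ R R, ketBra_conj, ← Matrix.mul_assoc, hp.expectation_sq] at h3
  simpa using h3

end OneSite

section Ferromagnetic
variable {μ : Type*} [Fintype μ] [DecidableEq μ] {w : Matrix (κ × κ) μ ℂ} {c : ℝ}
  {R R' : Matrix κ κ ℂ} {ε ε' : ℂ} {J J' : Finset Λ → ℝ}

/-- Ferromagnetic hamiltonians have Gibbs operators with nonnegative entries in the doubled
space. -/
theorem boltzmann_pairHamiltonian_mem (hw : IsOrthogonalFrame w c) (hε : ε * ε = 1)
    (hε' : ε' * ε' = 1) (hR : IsDoublePositive w ε R) (hR' : IsDoublePositive w ε' R')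
    (hJ : ∀ A, 0 ≤ J A) (hJ' : ∀ A, 0 ≤ J' A) (E : ℝ) {t : ℝ} (ht : 0 ≤ t) :
    boltzmann (pairHamiltonian R R' J J') E t ⊗ₖ boltzmann (pairHamiltonian R R' J J') E t ∈
      positiveCone (productFrame Λ w) := by
  refine boltzmann_kronecker_mem (isOrthogonalFrame_productFrame hw) ?_ E ht
  have h1 : IsDoublePositive (productFrame Λ w) ε (∑ A : Finset Λ, (J A : ℂ) • regionProd R A) :=
    IsDoublePositive.sum fun A _ =>
      (hR.regionProd hw hε A).smul (Complex.zero_le_real.2 (hJ A))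
  have h2 : IsDoublePositive (productFrame Λ w) ε'
      (∑ A : Finset Λ, (J' A : ℂ) • regionProd R' A) :=
    IsDoublePositive.sum fun A _ =>
      (hR'.regionProd hw hε' A).smul (Complex.zero_le_real.2 (hJ' A))
  convert add_mem_positiveCone h1.1 h2.1 using 1
  rw [pairHamiltonian, Finset.sum_add_distrib]
  generalize (∑ A : Finset Λ, (J A : ℂ) • regionProd R A) = a
  generalize (∑ A : Finset Λ, (J' A : ℂ) • regionProd R' A) = b
  ext i j
  simp only [Matrix.neg_apply, Matrix.add_apply, Matrix.kroneckerMap_apply]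
  ring

theorem groundProjection_kronecker_mem (hw : IsOrthogonalFrame w c) (hε : ε * ε = 1)
    (hε' : ε' * ε' = 1) (hR : IsDoublePositive w ε R) (hR' : IsDoublePositive w ε' R')
    (hJ : ∀ A, 0 ≤ J A) (hJ' : ∀ A, 0 ≤ J' A) {E : ℝ} {P : Matrix (Λ → κ) (Λ → κ) ℂ}
    (hP : IsGroundProjection (pairHamiltonian R R' J J') E P) :
    P ⊗ₖ P ∈ positiveCone (productFrame Λ w) := by
  refine tendsto_kronecker_mem hP.tendsto ?_
  filter_upwards [Filter.eventually_ge_atTop 0] with t ht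
  exact boltzmann_pairHamiltonian_mem hw hε hε' hR hR' hJ hJ' E ht

/-- By the Griffiths inequalities, if `∏_{y ∈ A} R_y²` has vanishing expectation then so has one of
the factors. -/
theorem exists_trace_sq_eq_zero (hw : IsOrthogonalFrame w c) (hε : ε * ε = 1)
    (hR : IsDoublePositive w ε R) {P : Matrix (Λ → κ) (Λ → κ) ℂ}
    (hP : P ⊗ₖ P ∈ positiveCone (productFrame Λ w)) (hpos : 0 < P.trace) (A : Finset Λ)
    (h : (regionProd (R * R) A * P).trace = 0) :
    ∃ y ∈ A, (siteEmbed y (R * R) * P).trace = 0 := by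
  have hW := isOrthogonalFrame_productFrame (Λ := Λ) hw
  have hRR := hR.mul hw hε hR
  induction A using Finset.induction_on with
  | empty => rw [regionProd_empty, Matrix.one_mul] at h; exact absurd h hpos.ne'
  | insert x A hx ih =>
    have h1 := (hRR.siteEmbed hw x).trace_mul_nonneg hW hP hpos
    have h2 := (hRR.regionProd hw hε A).trace_mul_nonneg hW hP hpos
    have h3 := (hRR.siteEmbed hw x).truncated_nonneg hW (hRR.regionProd hw hε A)
      (E := 1) (F := P) (by simpa using hW.one_mem) hP
    rw [Matrix.mul_one, Matrix.one_mul, Matrix.mul_one, ← regionProd_insert _ hx, h, hε,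
      zero_mul, zero_sub, one_mul, Left.nonneg_neg_iff] at h3
    rcases mul_eq_zero.1 (le_antisymm h3 (mul_nonneg h1 h2)) with h4 | h4
    · exact ⟨x, Finset.mem_insert_self x A, h4⟩
    · obtain ⟨y, hy, hy'⟩ := ih h4
      exact ⟨y, Finset.mem_insert_of_mem hy, hy'⟩

/-- At a site that occurs in the interaction, all ground states are triplets. -/
theorem singlet_mul_groundProjection_eq_zero (hw : IsOrthogonalFrame w c) (hε : ε * ε = 1)
    (hε' : ε' * ε' = 1) (hR : IsDoublePositive w ε R) (hR' : IsDoublePositive w ε' R')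
    (hJ : ∀ A, 0 ≤ J A) (hJ' : ∀ A, 0 ≤ J' A) {s : Matrix κ κ ℂ} {φ : Matrix κ Unit ℂ}
    (hp : IsTransversePair s φ R R') (hp' : IsTransversePair s φ R' R) (hss : s * s = s)
    (hs : s.trace = 1) {E : ℝ} {P : Matrix (Λ → κ) (Λ → κ) ℂ}
    (hP : IsGroundProjection (pairHamiltonian R R' J J') E P) {x : Λ} {A : Finset Λ}
    (hx : x ∈ A) (hA : J A ≠ 0) : siteEmbed x s * P = 0 := by
  by_contra hne
  have hW := isOrthogonalFrame_productFrame (Λ := Λ) hw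
  set H := pairHamiltonian R R' J J' with hHdef
  set H₀ := pairHamiltonian R R' (dropSite x J) (dropSite x J') with hH₀def
  have hH : H = H₀ - siteEmbed x R * siteField x R J - siteEmbed x R' * siteField x R' J' :=
    pairHamiltonian_eq x R R' J J'
  have hH₀ : ActsAwayFrom x H₀ := dropSite_actsAwayFrom x R R' J J'
  have hK := siteField_actsAwayFrom x R J
  have hK' := siteField_actsAwayFrom x R' J'
  set K := siteField x R J with hKdef
  set K' := siteField x R' J' with hK'def
  -- On singlets at `x` the two hamiltonians agree.
  have hHs : H * siteEmbed x s = H₀ * siteEmbed x s := by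
    rw [hH, Matrix.sub_mul, Matrix.sub_mul, Matrix.mul_assoc, ← (hK s).eq, ← Matrix.mul_assoc,
      ← siteEmbed_mul, hp.mul_singlet, Matrix.mul_assoc _ K', ← (hK' s).eq,
      ← Matrix.mul_assoc (siteEmbed x R'), ← siteEmbed_mul, hp'.mul_singlet, siteEmbed_zero]
    simp
  have hsH : siteEmbed x s * H = siteEmbed x s * H₀ := by
    rw [hH, Matrix.mul_sub, Matrix.mul_sub, ← Matrix.mul_assoc, ← siteEmbed_mul, hp.singlet_mul,
      ← Matrix.mul_assoc, ← siteEmbed_mul, hp'.singlet_mul, siteEmbed_zero]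
    simp
  have hX₀ : H₀ * (siteEmbed x s * P) = (E : ℂ) • (siteEmbed x s * P) := by
    rw [← Matrix.mul_assoc, ← (hH₀ s).eq, ← hsH, Matrix.mul_assoc, hP.mul_eq, Matrix.mul_smul]
  have hKX : K * (siteEmbed x s * P) = 0 := hp.field_mul_eq_zero hH hH₀ hK hK' hP hX₀
  obtain ⟨E', P', hP'⟩ : ∃ E' P', IsGroundProjection H₀ E' P' := by
    have : Nonempty (Λ → κ) := by
      by_contra h
      rw [not_nonempty_iff] at h
      exact hP.ne_zero (Subsingleton.elim _ _)
    exact exists_isGroundProjection (pairHamiltonian_isHermitian hp.isHermitian hp'.isHermitian _ _)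
  have hKP' : ActsAwayFrom x P' := fun M => hP'.commute_of_commute (hH₀ M)
  -- An operator away from `x` is determined by its restriction to singlets at `x`.
  have hinj : ∀ X : Matrix (Λ → κ) (Λ → κ) ℂ, ActsAwayFrom x X → siteEmbed x s * X = 0 →
      X = 0 := by
    intro X hX h0
    have h1 : siteEmbed x (∑ j, ∑ k, Matrix.single j k (1 : ℂ) * s * Matrix.single k j (1 : ℂ)) * X
        = 0 := by
      simp only [siteEmbed_sum, siteEmbed_mul, Finset.sum_mul]
      refine Finset.sum_eq_zero fun j _ => Finset.sum_eq_zero fun k _ => ?_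
      rw [Matrix.mul_assoc, (hX _).eq, Matrix.mul_assoc, ← Matrix.mul_assoc _ X, h0]
      simp
    rwa [sum_single_mul_mul_single, hs, one_smul, siteEmbed_one, Matrix.one_mul] at h1
  have hsP' : siteEmbed x s * P' ≠ 0 := fun h => hP'.ne_zero (hinj P' hKP' h)
  have hHsP' : H * (siteEmbed x s * P') = (E' : ℂ) • (siteEmbed x s * P') := by
    rw [← Matrix.mul_assoc, hHs, ← (hH₀ s).eq, Matrix.mul_assoc, hP'.mul_eq, Matrix.mul_smul]
  have hEE : E' = E := le_antisymm (hP'.le_eigenvalue hX₀ hne) (hP.le_eigenvalue hHsP' hsP')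
  have hKP0 : K * P' = 0 := by
    refine hinj _ (hK.mul hKP') ?_
    have h1 : P * (siteEmbed x s * P') = siteEmbed x s * P' := hP.mul_of_eigen (hEE ▸ hHsP')
    have h2 : siteEmbed x s * P' = siteEmbed x s * P * (siteEmbed x s * P') := by
      rw [Matrix.mul_assoc, h1, ← Matrix.mul_assoc, ← siteEmbed_mul, hss]
    rw [← Matrix.mul_assoc, (hK s).eq, Matrix.mul_assoc, h2, ← Matrix.mul_assoc, hKX,
      Matrix.zero_mul]
  have hcone : P' ⊗ₖ P' ∈ positiveCone (productFrame Λ w) := by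
    refine groundProjection_kronecker_mem hw hε hε' hR hR' ?_ ?_ hP' <;>
      · intro B
        unfold dropSite
        split_ifs
        · exact le_rfl
        · first | exact hJ B | exact hJ' B
  -- By the first Griffiths inequality each term of the field has vanishing square expectation.
  have hsq : (regionProd (R * R) (A.erase x) * P').trace = 0 := by
    have h1 : (regionProd R (A.erase x) * (K * P')).trace = 0 := by rw [hKP0]; simp
    rw [hKdef, siteField, Finset.sum_mul, Finset.mul_sum, Matrix.trace_sum,
      Finset.sum_eq_zero_iff_of_nonneg] at h1
    · have h2 := h1 A (Finset.mem_univ A)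
      rw [if_pos hx, Matrix.smul_mul, Matrix.mul_smul, Matrix.trace_smul, ← Matrix.mul_assoc,
        regionProd_mul_self] at h2
      exact (smul_eq_zero.1 h2).resolve_left (by exact_mod_cast hA)
    · intro B _
      split_ifs
      · rw [Matrix.smul_mul, Matrix.mul_smul, Matrix.trace_smul, ← Matrix.mul_assoc]
        exact mul_nonneg (Complex.zero_le_real.2 (hJ B))
          (((hR.regionProd hw hε _).mul hW hε (hR.regionProd hw hε _)).trace_mul_nonneg hW hcone
            hP'.trace_pos)
      · simp
  obtain ⟨y, -, hy⟩ := exists_trace_sq_eq_zero hw hε hR hcone hP'.trace_pos _ hsq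
  refine hp.siteEmbed_mul_ne_zero (x := y) (pairHamiltonian_eq y R R' _ _)
    (dropSite_actsAwayFrom y R R' _ _) (siteField_actsAwayFrom y R _)
    (siteField_actsAwayFrom y R' _) hP' ?_
  refine Matrix.trace_conjTranspose_mul_self_eq_zero_iff.1 ?_
  rw [Matrix.conjTranspose_mul, hP'.isHermitian.eq, siteEmbed_conjTranspose, hp.isHermitian.eq,
    Matrix.mul_assoc, Matrix.trace_mul_comm, Matrix.mul_assoc, Matrix.mul_assoc, hP'.mul_self,
    ← Matrix.mul_assoc, ← siteEmbed_mul, hy]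

end Ferromagnetic
end Strictness

/-! ### From the extended system to spin 1 -/

section SpinOne
variable {Λ : Type*} [Fintype Λ] [DecidableEq Λ]

theorem siteProd_eq_regionProd (M : Matrix (Fin 3) (Fin 3) ℂ) (A : Finset Λ) :
    siteProd M A = regionProd M A := by
  induction A using Finset.induction_on with
  | empty => rw [regionProd_empty]; exact Finset.noncommProd_empty _ _
  | insert x A hx ih =>
    rw [regionProd_insert M hx, ← ih]
    have h : siteOp M x = siteEmbed x M := by
      unfold siteOp siteEmbed
      change piTensor _ = piTensor _
      congr 1
      funext y
      rw [Pi.mulSingle_apply]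
    rw [← h]
    exact Finset.noncommProd_insert_of_notMem _ _ _ _ hx

/-- The isometry from the spin-1 system onto the states which are triplets at all sites. -/
noncomputable def globalIso (Λ : Type*) [Fintype Λ] :
    Matrix (Λ → Fin 2 × Fin 2) (Λ → Fin 3) ℂ :=
  piTensor fun _ => tripletIso

theorem globalIso_conjTranspose_mul : (globalIso Λ)ᴴ * globalIso Λ = 1 := by
  unfold globalIso
  rw [piTensor_conjTranspose, piTensor_mul]
  simp only [tripletIso_conjTranspose_mul, piTensor_one]

theorem globalIso_mul_conjTranspose :
    globalIso Λ * (globalIso Λ)ᴴ = regionProd tripletProj Finset.univ := by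
  unfold globalIso
  rw [piTensor_conjTranspose, piTensor_mul]
  simp [regionProd, tripletProj]

theorem regionProd_mul_globalIso (S : Matrix (Fin 3) (Fin 3) ℂ) (A : Finset Λ) :
    regionProd (tripletIso * S * tripletIsoᴴ) A * globalIso Λ =
      globalIso Λ * regionProd S A := by
  unfold globalIso regionProd
  rw [piTensor_mul, piTensor_mul]
  congr 1
  funext y
  split_ifs
  · rw [Matrix.mul_assoc, tripletIso_conjTranspose_mul, Matrix.mul_one]
  · simp

theorem pairHamiltonian_mul_globalIso (J₁ J₂ : Finset Λ → ℝ) :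
    pairHamiltonian (pairSpin pauli1) (pairSpin pauli2) J₁ J₂ * globalIso Λ =
      globalIso Λ * xyHamiltonian J₁ J₂ := by
  rw [pairSpin_pauli1, pairSpin_pauli2]
  simp only [pairHamiltonian, xyHamiltonian, Matrix.neg_mul, Matrix.mul_neg, Matrix.sum_mul,
    Matrix.mul_sum, Matrix.add_mul, Matrix.mul_add, Matrix.smul_mul, Matrix.mul_smul,
    regionProd_mul_globalIso, siteProd_eq_regionProd]

theorem boltzmann_mul_globalIso (J₁ J₂ : Finset Λ → ℝ) (E t : ℝ) :
    boltzmann (pairHamiltonian (pairSpin pauli1) (pairSpin pauli2) J₁ J₂) E t * globalIso Λ =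
      globalIso Λ * boltzmann (xyHamiltonian J₁ J₂) E t := by
  unfold boltzmann
  rw [Matrix.smul_mul, Matrix.mul_smul]
  congr 1
  refine exp_mul_eq_mul_exp ?_
  rw [Matrix.smul_mul, pairHamiltonian_mul_globalIso, Matrix.mul_smul]

/-- The trace over the spin-1 system is the trace over the triplets of the extended system. -/
theorem trace_eq_of_intertwining {X : SpinOp Λ}
    {Y : Matrix (Λ → Fin 2 × Fin 2) (Λ → Fin 2 × Fin 2) ℂ}
    (h : Y * globalIso Λ = globalIso Λ * X) :
    X.trace = (regionProd tripletProj Finset.univ * Y).trace := by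
  rw [← globalIso_mul_conjTranspose, Matrix.mul_assoc, Matrix.trace_mul_comm,
    Matrix.mul_assoc, h, ← Matrix.mul_assoc, globalIso_conjTranspose_mul, Matrix.one_mul]

theorem schwinger_eq (J₁ J₂ : Finset Λ → ℝ) (E β s : ℝ) (S S' : Matrix (Fin 3) (Fin 3) ℂ)
    (A B : Finset Λ) :
    schwinger (xyHamiltonian J₁ J₂) β s (siteProd S A) (siteProd S' B) =
    (regionProd tripletProj Finset.univ * (regionProd (tripletIso * S * tripletIsoᴴ) A *
      boltzmann (pairHamiltonian (pairSpin pauli1) (pairSpin pauli2) J₁ J₂) E (s * β) *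
      regionProd (tripletIso * S' * tripletIsoᴴ) B *
      boltzmann (pairHamiltonian (pairSpin pauli1) (pairSpin pauli2) J₁ J₂) E
        ((1 - s) * β))).trace /
    (regionProd tripletProj Finset.univ *
      boltzmann (pairHamiltonian (pairSpin pauli1) (pairSpin pauli2) J₁ J₂) E β).trace := by
  have hB := boltzmann_mul_globalIso J₁ J₂ E
  have hR := fun S => regionProd_mul_globalIso (Λ := Λ) S
  rw [← trace_eq_of_intertwining (hB β)]
  rw [← trace_eq_of_intertwining (X := regionProd S A * boltzmann (xyHamiltonian J₁ J₂) E (s * β) *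
    regionProd S' B * boltzmann (xyHamiltonian J₁ J₂) E ((1 - s) * β))]
  · unfold schwinger partitionFn boltzmann
    simp only [Matrix.smul_mul, Matrix.mul_smul, Matrix.trace_smul, smul_eq_mul,
      siteProd_eq_regionProd]
    rw [← mul_assoc, ← Complex.exp_add,
      show (((1 - s) * β * E : ℝ) : ℂ) + ((s * β * E : ℝ) : ℂ) = ((β * E : ℝ) : ℂ) by
        push_cast; ring, mul_div_mul_left _ _ (Complex.exp_ne_zero _)]
  · rw [Matrix.mul_assoc _ _ (globalIso Λ), hB, ← Matrix.mul_assoc,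
      Matrix.mul_assoc _ _ (globalIso Λ),
      hR, ← Matrix.mul_assoc, Matrix.mul_assoc _ _ (globalIso Λ), hB, ← Matrix.mul_assoc, hR]
    simp only [Matrix.mul_assoc]

theorem gibbs_eq (J₁ J₂ : Finset Λ → ℝ) (E β : ℝ) (S : Matrix (Fin 3) (Fin 3) ℂ)
    (A : Finset Λ) :
    gibbs (xyHamiltonian J₁ J₂) β (siteProd S A) =
    (regionProd tripletProj Finset.univ * (regionProd (tripletIso * S * tripletIsoᴴ) A *
      boltzmann (pairHamiltonian (pairSpin pauli1) (pairSpin pauli2) J₁ J₂) E β)).trace /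
    (regionProd tripletProj Finset.univ *
      boltzmann (pairHamiltonian (pairSpin pauli1) (pairSpin pauli2) J₁ J₂) E β).trace := by
  have hB := boltzmann_mul_globalIso J₁ J₂ E
  have hR := fun S => regionProd_mul_globalIso (Λ := Λ) S
  rw [← trace_eq_of_intertwining (hB β)]
  rw [← trace_eq_of_intertwining (X := regionProd S A * boltzmann (xyHamiltonian J₁ J₂) E β)]
  · unfold gibbs partitionFn boltzmann
    simp only [Matrix.mul_smul, Matrix.trace_smul, smul_eq_mul, siteProd_eq_regionProd]
    rw [mul_div_mul_left _ _ (Complex.exp_ne_zero _)]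
  · rw [Matrix.mul_assoc, hB, ← Matrix.mul_assoc, hR, Matrix.mul_assoc]

/-- Inserting the projection onto the triplets changes a trace by a factor `3/4` for each site on
which nothing else acts; at all other sites the operator is assumed to have range in the
triplets. -/
theorem trace_regionProd_tripletProj_mul {T : Finset Λ}
    {X : Matrix (Λ → Fin 2 × Fin 2) (Λ → Fin 2 × Fin 2) ℂ}
    (h1 : ∀ x, x ∉ T → siteEmbed x tripletProj * X = X) (h2 : ∀ x, x ∈ T → ActsAwayFrom x X) :
    (regionProd tripletProj Finset.univ * X).trace = (3 / 4 : ℂ) ^ T.card * X.trace := by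
  have key : ∀ F : Finset Λ, (regionProd tripletProj F * X).trace =
      (3 / 4 : ℂ) ^ (F ∩ T).card * X.trace := by
    intro F
    induction F using Finset.induction_on with
    | empty => simp [regionProd_empty]
    | insert x F hx ih =>
      rw [regionProd_insert _ hx]
      by_cases hT : x ∈ T
      · have h3 := ((regionProd_actsAwayFrom tripletProj hx).mul (h2 x hT)).trace_siteEmbed_mul
          tripletProj
        rw [trace_tripletProj, ih] at h3
        rw [Finset.insert_inter_of_mem hT, Finset.card_insert_of_notMem (by simp [hx]), pow_succ,
          Matrix.mul_assoc]
        have h4 : (Fintype.card (Fin 2 × Fin 2) : ℂ) = 4 := by norm_num [Fintype.card_prod]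
        rw [h4] at h3
        linear_combination h3 / 4
      · rw [Finset.insert_inter_of_notMem hT, ← ih,
          (regionProd_actsAwayFrom tripletProj hx tripletProj).eq, Matrix.mul_assoc, h1 x hT]
  rw [key, Finset.univ_inter]

/-- The limit of `e^{sβ(E - H)}` as `β → ∞`. -/
theorem IsGroundProjection.tendsto_mul {n : Type*} [Fintype n] [DecidableEq n]
    {H P : Matrix n n ℂ} {E : ℝ} (hP : IsGroundProjection H E P) {s : ℝ} (hs : 0 ≤ s) :
    Filter.Tendsto (fun β : ℝ => boltzmann H E (s * β)) Filter.atTop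
      (nhds (if s = 0 then 1 else P)) := by
  split_ifs with h
  · have : (fun β : ℝ => boltzmann H E (s * β)) = fun _ => 1 := by
      funext β
      simp [boltzmann, h, NormedSpace.exp_zero]
    rw [this]
    exact tendsto_const_nhds
  · exact hP.tendsto.comp (Filter.tendsto_id.const_mul_atTop (lt_of_le_of_ne hs (Ne.symm h)))

theorem trace_regionProd_mul_eq_zero {κ : Type*} [Fintype κ] [DecidableEq κ] [Nonempty κ] {x : Λ}
    {A : Finset Λ} (hx : x ∈ A) {R : Matrix κ κ ℂ} (hR : R.trace = 0)
    {P : Matrix (Λ → κ) (Λ → κ) ℂ} (hP : ActsAwayFrom x P) : (regionProd R A * P).trace = 0 := by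
  rw [← Finset.insert_erase hx, regionProd_insert _ (Finset.notMem_erase x A), Matrix.mul_assoc]
  have h := ((regionProd_actsAwayFrom R (Finset.notMem_erase x A)).mul hP).trace_siteEmbed_mul R
  rw [hR, zero_mul] at h
  exact (mul_eq_zero.1 h).resolve_left (by exact_mod_cast Fintype.card_ne_zero)

/-- The truncated ground state correlations of two families of spin operators, where
`tripletIso * S * tripletIsoᴴ` is doubly positive with sign `ε`, and likewise for `S'` and `δ`. -/
theorem exists_tendsto_truncated {J₁ J₂ : Finset Λ → ℝ} (hJ₁ : ∀ A, 0 ≤ J₁ A)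
    (hJ₂ : ∀ A, 0 ≤ J₂ A) (A B : Finset Λ) {s : ℝ} (hs : s ∈ Set.Icc (0 : ℝ) 1)
    {S S' : Matrix (Fin 3) (Fin 3) ℂ} {ε δ : ℂ} (hε : ε * ε = 1) (hδ : δ * δ = 1)
    (hS : IsDoublePositive siteFrame ε (tripletIso * S * tripletIsoᴴ))
    (hS' : IsDoublePositive siteFrame δ (tripletIso * S' * tripletIsoᴴ))
    (htr : S.trace = 0) (htr' : S'.trace = 0) :
    ∃ l : ℂ, Filter.Tendsto (fun β : ℝ =>
      schwinger (xyHamiltonian J₁ J₂) β s (siteProd S A) (siteProd S' B) -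
        gibbs (xyHamiltonian J₁ J₂) β (siteProd S A) *
          gibbs (xyHamiltonian J₁ J₂) β (siteProd S' B)) Filter.atTop (nhds l) ∧
      0 ≤ ε * δ * l := by
  have hw := isOrthogonalFrame_siteFrame
  have hW := isOrthogonalFrame_productFrame (Λ := Λ) hw
  have hp1 : IsDoublePositive siteFrame 1 (pairSpin pauli1) :=
    isDoublePositive_pairSpin pauli1_add_mem (by rw [one_smul]; exact pauli1_sub_mem)
  have hp2 : IsDoublePositive siteFrame (-1) (pairSpin pauli2) :=
    isDoublePositive_pairSpin pauli2_add_mem neg_pauli2_sub_mem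
  have ht1 := isTransversePair_pairSpin1
  have ht2 := isTransversePair_pairSpin2
  set H := pairHamiltonian (pairSpin pauli1) (pairSpin pauli2) J₁ J₂ with hHdef
  obtain ⟨E, P, hP⟩ := exists_isGroundProjection
    (pairHamiltonian_isHermitian (Λ := Λ) ht1.isHermitian ht2.isHermitian J₁ J₂)
  rw [← hHdef] at hP
  have htrR : ∀ M : Matrix (Fin 3) (Fin 3) ℂ, (tripletIso * M * tripletIsoᴴ).trace = M.trace := by
    intro M
    rw [Matrix.trace_mul_comm, ← Matrix.mul_assoc, tripletIso_conjTranspose_mul, Matrix.one_mul]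
  set R := tripletIso * S * tripletIsoᴴ with hR
  set R' := tripletIso * S' * tripletIsoᴴ with hR'
  classical
  -- The sites that do not occur in the interaction.
  let U : Finset Λ := Finset.univ.filter fun x => ∀ C, x ∈ C → J₁ C = 0 ∧ J₂ C = 0
  have hUH : ∀ x, x ∈ U → ActsAwayFrom x H := by
    intro x hx
    have hx' := (Finset.mem_filter.1 hx).2
    exact pairHamiltonian_actsAwayFrom _ _ (fun C hC => (hx' C hC).1) fun C hC => (hx' C hC).2
  have hUP : ∀ x, x ∈ U → ActsAwayFrom x P := fun x hx M => hP.commute_of_commute (hUH x hx M)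
  have hss : (1 - tripletProj) * (1 - tripletProj) = 1 - tripletProj := by
    rw [Matrix.mul_sub, Matrix.sub_mul, Matrix.sub_mul, tripletProj_mul_self]; simp
  have hstr : (1 - tripletProj).trace = 1 := by
    rw [Matrix.trace_sub, trace_tripletProj, Matrix.trace_one]; norm_num
  have hQP : ∀ x, x ∉ U → siteEmbed x tripletProj * P = P := by
    intro x hx
    have h0 : siteEmbed x (1 - tripletProj) * P = 0 := by
      obtain ⟨C, hC, hne⟩ : ∃ C, x ∈ C ∧ (J₁ C ≠ 0 ∨ J₂ C ≠ 0) := by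
        by_contra hcon
        refine hx (Finset.mem_filter.2 ⟨Finset.mem_univ x, fun C hC => ?_⟩)
        by_contra h
        exact hcon ⟨C, hC, by tauto⟩
      rcases hne with hne | hne
      · exact singlet_mul_groundProjection_eq_zero hw (by norm_num) (by norm_num) hp1 hp2 hJ₁ hJ₂
          ht1 ht2 hss hstr hP hC hne
      · rw [hHdef, pairHamiltonian_swap] at hP
        exact singlet_mul_groundProjection_eq_zero hw (by norm_num) (by norm_num) hp2 hp1 hJ₂ hJ₁
          ht2 ht1 hss hstr hP hC hne
    rw [siteEmbed_sub, siteEmbed_one, Matrix.sub_mul, Matrix.one_mul, sub_eq_zero] at h0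
    exact h0.symm
  have hcR : ∀ (M : Matrix (Fin 3) (Fin 3) ℂ) (x : Λ) (C : Finset Λ),
      Commute (siteEmbed x tripletProj) (regionProd (tripletIso * M * tripletIsoᴴ) C) := by
    intro M x C
    refine siteEmbed_commute_regionProd fun _ => ?_
    unfold Commute SemiconjBy
    rw [tripletProj_mul, mul_tripletProj]
  have hcH : ∀ x, Commute (siteEmbed x tripletProj) H := by
    intro x
    rw [hHdef, pairHamiltonian, pairSpin_pauli1, pairSpin_pauli2]
    refine Commute.neg_right (Commute.sum_right _ _ _ fun C _ => ?_)
    exact ((hcR _ x C).smul_right _).add_right ((hcR _ x C).smul_right _)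
  have hcP : ∀ x, Commute (siteEmbed x tripletProj) P := fun x => hP.commute_of_commute (hcH x)
  have hQR : ∀ (M : Matrix (Fin 3) (Fin 3) ℂ) (x : Λ) (C : Finset Λ), x ∈ C →
      siteEmbed x tripletProj * regionProd (tripletIso * M * tripletIsoᴴ) C =
        regionProd (tripletIso * M * tripletIsoᴴ) C := by
    intro M x C hx
    rw [← Finset.insert_erase hx, regionProd_insert _ (Finset.notMem_erase x C),
      ← Matrix.mul_assoc, ← siteEmbed_mul, tripletProj_mul]
  -- The limits of the Gibbs operators.
  let L : ℝ → Matrix (Λ → Fin 2 × Fin 2) (Λ → Fin 2 × Fin 2) ℂ := fun r => if r = 0 then 1 else P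
  have hL : ∀ r, 0 ≤ r → Filter.Tendsto (fun β : ℝ => boltzmann H E (r * β)) Filter.atTop
      (nhds (L r)) := fun r hr => hP.tendsto_mul hr
  have hs1 : 0 ≤ 1 - s := by linarith [hs.2]
  have hLU : ∀ r x, x ∈ U → ActsAwayFrom x (L r) := by
    intro r x hx
    simp only [L]
    split_ifs
    · exact fun M => Commute.one_right _
    · exact hUP x hx
  have hLc : ∀ r x, Commute (siteEmbed x tripletProj) (L r) := by
    intro r x
    simp only [L]
    split_ifs
    · exact Commute.one_right _
    · exact hcP x
  have hLmem : ∀ r, 0 ≤ r → L r ⊗ₖ L r ∈ positiveCone (productFrame Λ siteFrame) := by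
    intro r hr
    refine tendsto_kronecker_mem (hL r hr) ?_
    filter_upwards [Filter.eventually_ge_atTop 0] with β hβ
    exact boltzmann_pairHamiltonian_mem hw (by norm_num) (by norm_num) hp1 hp2 hJ₁ hJ₂ E
      (mul_nonneg hr hβ)
  have hLL : L s * L (1 - s) = P ∧ L (1 - s) * L s = P := by
    simp only [L]
    by_cases h0 : s = 0
    · simp [h0]
    · by_cases h1 : 1 - s = 0
      · simp [h0, h1]
      · simp [h0, h1, hP.mul_self]
  -- The traces over the spin-1 system.
  have hZ : (regionProd tripletProj Finset.univ * P).trace = (3 / 4 : ℂ) ^ U.card * P.trace :=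
    trace_regionProd_tripletProj_mul hQP hUP
  have hG : ∀ (M : Matrix (Fin 3) (Fin 3) ℂ) (C : Finset Λ),
      (regionProd tripletProj Finset.univ *
        (regionProd (tripletIso * M * tripletIsoᴴ) C * P)).trace =
      (3 / 4 : ℂ) ^ (U \ C).card * (regionProd (tripletIso * M * tripletIsoᴴ) C * P).trace := by
    intro M C
    refine trace_regionProd_tripletProj_mul ?_ ?_
    · intro x hx
      rw [← Matrix.mul_assoc]
      by_cases hC : x ∈ C
      · rw [hQR M x C hC]
      · have hxU : x ∉ U := fun h => hx (Finset.mem_sdiff.2 ⟨h, hC⟩)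
        rw [(hcR M x C).eq, Matrix.mul_assoc, hQP x hxU]
    · intro x hx
      obtain ⟨hxU, hC⟩ := Finset.mem_sdiff.1 hx
      exact (regionProd_actsAwayFrom _ hC).mul (hUP x hxU)
  have hN : (regionProd tripletProj Finset.univ *
      (regionProd R A * L s * regionProd R' B * L (1 - s))).trace =
      (3 / 4 : ℂ) ^ (U \ (A ∪ B)).card *
        (regionProd R A * L s * regionProd R' B * L (1 - s)).trace := by
    refine trace_regionProd_tripletProj_mul ?_ ?_
    · intro x hx
      have c1 := (hcR S x A).eq
      have c2 := (hLc s x).eq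
      have c3 := (hcR S' x B).eq
      have d1 := hQR S x A
      have d3 := hQR S' x B
      rw [← hR] at c1 d1
      rw [← hR'] at c3 d3
      have d2 : x ∉ U → siteEmbed x tripletProj * L s = L s ∨
          siteEmbed x tripletProj * L (1 - s) = L (1 - s) := by
        intro hxU
        by_cases h0 : s = 0
        · right; simp [L, h0, hQP x hxU]
        · left; simp [L, h0, hQP x hxU]
      generalize siteEmbed x tripletProj = q at *
      generalize regionProd R A = a at *
      generalize regionProd R' B = b at *
      generalize L s = p at *
      generalize L (1 - s) = p' at *
      have e1 : q * (a * p * b * p') = a * (q * p) * b * p' := by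
        rw [← Matrix.mul_assoc, ← Matrix.mul_assoc, ← Matrix.mul_assoc, c1, Matrix.mul_assoc a]
      have e2 : q * (a * p * b * p') = a * p * (q * b) * p' := by
        rw [e1, c2]; simp only [Matrix.mul_assoc]
      have e3 : q * (a * p * b * p') = a * p * b * (q * p') := by
        rw [e2, c3]; simp only [Matrix.mul_assoc]
      by_cases hA : x ∈ A
      · rw [← Matrix.mul_assoc, ← Matrix.mul_assoc, ← Matrix.mul_assoc, d1 hA]
      by_cases hB : x ∈ B
      · rw [e2, d3 hB]
      have hxU : x ∉ U := fun h => hx (Finset.mem_sdiff.2 ⟨h, by simp [hA, hB]⟩)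
      rcases d2 hxU with h | h
      · rw [e1, h]
      · rw [e3, h]
    · intro x hx
      obtain ⟨hxU, hC⟩ := Finset.mem_sdiff.1 hx
      rw [Finset.mem_union, not_or] at hC
      exact (((regionProd_actsAwayFrom _ hC.1).mul (hLU s x hxU)).mul
        (regionProd_actsAwayFrom _ hC.2)).mul (hLU (1 - s) x hxU)
  have hpos := hP.trace_pos
  have hZ0 : (regionProd tripletProj Finset.univ * P).trace ≠ 0 := by
    rw [hZ]
    exact mul_ne_zero (pow_ne_zero _ (by norm_num)) hpos.ne'
  -- The Griffiths inequality in the extended system.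
  have hgriff := hS.regionProd hw hε A |>.truncated_nonneg hW (hS'.regionProd hw hδ B)
    (hLmem s hs.1) (hLmem (1 - s) hs1)
  rw [hLL.1, hLL.2] at hgriff
  refine ⟨(regionProd tripletProj Finset.univ *
      (regionProd R A * L s * regionProd R' B * L (1 - s))).trace /
      (regionProd tripletProj Finset.univ * P).trace -
      (regionProd tripletProj Finset.univ * (regionProd R A * P)).trace /
      (regionProd tripletProj Finset.univ * P).trace *
      ((regionProd tripletProj Finset.univ * (regionProd R' B * P)).trace /
      (regionProd tripletProj Finset.univ * P).trace), ?_, ?_⟩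
  · have htrace : ∀ X : Matrix (Λ → Fin 2 × Fin 2) (Λ → Fin 2 × Fin 2) ℂ,
        ∀ f : ℝ → Matrix (Λ → Fin 2 × Fin 2) (Λ → Fin 2 × Fin 2) ℂ,
        Filter.Tendsto f Filter.atTop (nhds X) →
        Filter.Tendsto (fun β => (regionProd tripletProj Finset.univ * f β).trace) Filter.atTop
          (nhds (regionProd tripletProj Finset.univ * X).trace) := by
      intro X f hf
      exact ((continuous_const.matrix_mul continuous_id).matrix_trace.tendsto X).comp hf
    have hB := hP.tendsto
    simp only [schwinger_eq J₁ J₂ E, gibbs_eq J₁ J₂ E, ← hHdef, ← hR, ← hR']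
    refine Filter.Tendsto.sub (Filter.Tendsto.div (htrace _ _ ?_) (htrace _ _ hB) hZ0)
      (Filter.Tendsto.mul (Filter.Tendsto.div (htrace _ _ ?_) (htrace _ _ hB) hZ0)
        (Filter.Tendsto.div (htrace _ _ ?_) (htrace _ _ hB) hZ0))
    · exact ((tendsto_const_nhds.mul (hL s hs.1)).mul tendsto_const_nhds).mul (hL (1 - s) hs1)
    · exact tendsto_const_nhds.mul hB
    · exact tendsto_const_nhds.mul hB
  · have hGA := hG S A
    have hGB := hG S' B
    rw [← hR] at hGA
    rw [← hR'] at hGB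
    rw [hN, hGA, hGB, hZ]
    have hz1 : (regionProd R A * P).trace = 0 ∨ U \ A = U := by
      by_cases h : ∃ x ∈ U, x ∈ A
      · obtain ⟨x, hxU, hxA⟩ := h
        exact Or.inl (trace_regionProd_mul_eq_zero hxA (by rw [hR, htrR, htr]) (hUP x hxU))
      · right
        rw [Finset.sdiff_eq_self_iff_disjoint, Finset.disjoint_left]
        exact fun x hxU hxA => h ⟨x, hxU, hxA⟩
    have hz2 : (regionProd R' B * P).trace = 0 ∨ U \ B = U := by
      by_cases h : ∃ x ∈ U, x ∈ B
      · obtain ⟨x, hxU, hxB⟩ := h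
        exact Or.inl (trace_regionProd_mul_eq_zero hxB (by rw [hR', htrR, htr']) (hUP x hxU))
      · right
        rw [Finset.sdiff_eq_self_iff_disjoint, Finset.disjoint_left]
        exact fun x hxU hxB => h ⟨x, hxU, hxB⟩
    have hz3 : U \ A = U → U \ B = U → U \ (A ∪ B) = U := by
      intro h1 h2
      rw [Finset.sdiff_union_distrib, h1, h2, Finset.inter_self]
    generalize (regionProd R A * L s * regionProd R' B * L (1 - s)).trace = x at *
    generalize (regionProd R A * P).trace = a at *
    generalize (regionProd R' B * P).trace = b at *
    generalize P.trace = p at *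
    have hp0 := hpos.ne'
    have hu : ((3 / 4 : ℂ)) ^ U.card ≠ 0 := pow_ne_zero _ (by norm_num)
    -- A site outside the interaction that occurs in `A` or `B` makes the product of the
    -- expectations vanish; otherwise the powers of `3/4` cancel.
    have hkey : ε * δ * ((3 / 4 : ℂ) ^ (U \ (A ∪ B)).card * x / ((3 / 4 : ℂ) ^ U.card * p) -
        (3 / 4 : ℂ) ^ (U \ A).card * a / ((3 / 4 : ℂ) ^ U.card * p) *
        ((3 / 4 : ℂ) ^ (U \ B).card * b / ((3 / 4 : ℂ) ^ U.card * p))) =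
        ((3 / 4 : ℂ) ^ (U \ (A ∪ B)).card * ((3 / 4 : ℂ) ^ U.card)⁻¹ * (p⁻¹ * p⁻¹)) *
          (ε * δ * (x * p - a * b)) := by
      rcases hz1 with h | h
      · rw [h]; field_simp; ring
      · rcases hz2 with h' | h'
        · rw [h']; field_simp; ring
        · rw [hz3 h h', h, h']; field_simp
    rw [hkey]
    refine mul_nonneg (mul_nonneg (mul_nonneg (by positivity) ?_) ?_) hgriff
    · rw [← inv_pow]; positivity
    · positivity

end SpinOne

theorem theorem2 {Λ : Type*} [Fintype Λ] [DecidableEq Λ] (J₁ J₂ : Finset Λ → ℝ)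
    (hJ₁ : ∀ A, 0 ≤ J₁ A) (hJ₂ : ∀ A, 0 ≤ J₂ A)
    (A B : Finset Λ) (s : ℝ) (hs : s ∈ Set.Icc (0 : ℝ) 1) :
    (∃ l : ℝ, Filter.Tendsto
        (fun β : ℝ =>
          schwinger (xyHamiltonian J₁ J₂) β s (siteProd spinOne1 A) (siteProd spinOne1 B) -
            gibbs (xyHamiltonian J₁ J₂) β (siteProd spinOne1 A) *
              gibbs (xyHamiltonian J₁ J₂) β (siteProd spinOne1 B))
        Filter.atTop (nhds (l : ℂ)) ∧ 0 ≤ l) ∧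
    (∃ l : ℝ, Filter.Tendsto
        (fun β : ℝ =>
          schwinger (xyHamiltonian J₁ J₂) β s (siteProd spinOne1 A) (siteProd spinOne2 B) -
            gibbs (xyHamiltonian J₁ J₂) β (siteProd spinOne1 A) *
              gibbs (xyHamiltonian J₁ J₂) β (siteProd spinOne2 B))
        Filter.atTop (nhds (l : ℂ)) ∧ l ≤ 0) := by
  have hp1 : IsDoublePositive siteFrame 1 (tripletIso * spinOne1 * tripletIsoᴴ) := by
    rw [← pairSpin_pauli1]
    exact isDoublePositive_pairSpin pauli1_add_mem (by rw [one_smul]; exact pauli1_sub_mem)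
  have hp2 : IsDoublePositive siteFrame (-1) (tripletIso * spinOne2 * tripletIsoᴴ) := by
    rw [← pairSpin_pauli2]
    exact isDoublePositive_pairSpin pauli2_add_mem neg_pauli2_sub_mem
  have ht1 : spinOne1.trace = 0 := by simp [spinOne1, Matrix.trace, Fin.sum_univ_three]
  have ht2 : spinOne2.trace = 0 := by simp [spinOne2, Matrix.trace, Fin.sum_univ_three]
  obtain ⟨l, hl, hl0⟩ := exists_tendsto_truncated hJ₁ hJ₂ A B hs (by norm_num) (by norm_num)
    hp1 hp1 ht1 ht1
  obtain ⟨m, hm, hm0⟩ := exists_tendsto_truncated hJ₁ hJ₂ A B hs (by norm_num) (by norm_num)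
    hp1 hp2 ht1 ht2
  rw [one_mul, one_mul] at hl0
  rw [one_mul, neg_one_mul, Left.nonneg_neg_iff] at hm0
  have hlr : ((l.re : ℝ) : ℂ) = l := Complex.ext rfl (Complex.le_def.1 hl0).2
  have hmr : ((m.re : ℝ) : ℂ) = m := Complex.ext rfl (Complex.le_def.1 hm0).2.symm
  refine ⟨⟨l.re, ?_, (Complex.le_def.1 hl0).1⟩, ⟨m.re, ?_, (Complex.le_def.1 hm0).1⟩⟩
  · rw [hlr]
    exact hl
  · rw [hmr]
    exact hm
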